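/- Let $B$ be a standard real Brownian motion, $\sigma\in(0,\infty)$, and let $\mu:(0,\infty)\to(0,\infty)$ be strictly decreasing and continuous with $\lim_{a\to0^+}\mu(a)=\infty$; put $\mu(\infty):=\lim_{a\to\infty}\mu(a)\ge 0$. For $t\ge 0$ let $X_t(0):=0$ and $X_t(a):=\sigma B_t-\mu(a)t$ for $a\in(0,\infty]$, and let $M_*(a):=\sup_{t\ge0}X_t(a)$ for $a\in[0,\infty]$. Let $w$ be a finite initial condition, that is, a stochastic process $w:\mathbb{R}_+\to\mathbb{R}_+$, independent of $B$, with continuous nondecreasing paths, $w(0)=0$, $\mathbb{E}\big[\int_0^1 w(a)a^{-2}\,da\big]<\infty$ and $\mathbb{E}[w(\infty)]<\infty$, where $w(\infty):=\lim_{a\to\infty}w(a)$. For $t\ge0$ and $a\in[0,\infty]$ let $\chi_t(a):=w(a)+X_t(a)$ and $$W_t^w(a):=\chi_t(a)-\Big(\inf_{0\le s\le t}\chi_s(a)\Big)\wedge 0 .$$ Let $\mathbf{C}(\mathbb{R}_+)$ be the space of continuous real functions on $\mathbb{R}_+$ with the topology of uniform convergence on compact sets, and $\mathbb{M}$ the space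 of finite nonnegative Borel measures on $\mathbb{R}_+$ with the topology of weak convergence. (i) Almost surely, $W_t^w(\cdot)$ is nonnegative and continuous on $\mathbb{R}_+$ for every $t\ge0$, and $M_*(\cdot)$ is nonnegative, finite and continuous on $\mathbb{R}_+$. As $t\to\infty$, $W_t^w(\cdot)\to M_*(\cdot)$ in distribution in $\mathbf{C}(\mathbb{R}_+)$. If $\mu(\infty)>0$, then $M_*(\infty)<\infty$ almost surely and $(W_t^w(\cdot),W_t^w(\infty))\to(M_*(\cdot),M_*(\infty))$ in distribution in $\mathbf{C}(\mathbb{R}_+)\times\mathbb{R}_+$ as $t\to\infty$. (ii) Suppose in addition that $\int_0^\infty\frac{da}{a^2\mu(a)}<\infty$. Then, for each $t\ge0$, almost surely there is a unique $\mathcal{Z}_t^w\in\mathbb{M}$ with $$\mathcal{Z}_t^w(\{0\})=0,\qquad \mathcal{Z}_t^w([0,a])=\int_0^a\frac{W_t^w(x)}{x^2}\,dx+\frac{W_t^w(a)}{a}\quad(0<a<\infty),\qquad \mathcal{Z}_t^w([0,\infty))=\int_0^\infty\frac{W_t^w(x)}{x^2}\,dx,$$ and almost surely there is a unique $\mathcal{M}_*\in\mathbb{M}$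 that satisfies the same three relations with $M_*$ in place of $W_t^w$. As $t\to\infty$, $(W_t^w(\cdot),\mathcal{Z}_t^w)\to(M_*(\cdot),\mathcal{M}_*)$ in distribution in $\mathbf{C}(\mathbb{R}_+)\times\mathbb{M}$. If moreover $\mu(\infty)>0$, then $(W_t^w(\cdot),W_t^w(\infty),\mathcal{Z}_t^w)\to(M_*(\cdot),M_*(\infty),\mathcal{M}_*)$ in distribution in $\mathbf{C}(\mathbb{R}_+)\times\mathbb{R}_+\times\mathbb{M}$ as $t\to\infty$. -/

import Mathlib

open MeasureTheory ProbabilityTheory Filter Topology Set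
open scoped NNReal ENNReal

noncomputable section

namespace RCBM

/-- A drift function: strictly decreasing and continuous from `(0, ∞)` to `(0, ∞)`, with
limit `∞` at `0+`. Only the values of `μ` on `(0, ∞)` matter. -/
structure IsDriftFunction (μ : ℝ → ℝ) : Prop where
  pos : ∀ a, 0 < a → 0 < μ a
  strictAnti : StrictAntiOn μ (Ioi 0)
  continuousOn : ContinuousOn μ (Ioi 0)
  tendsto_zero : Tendsto μ (𝓝[>] 0) atTop

/-- `μ(∞) = lim_{a → ∞} μ(a)`; the limit exists for every drift function. -/
def driftAtInfty (μ : ℝ → ℝ) : ℝ := limUnder atTop μ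

/-- The drift function extended to `(0, ∞]`. -/
def driftExt (μ : ℝ → ℝ) (a : ℝ≥0∞) : ℝ :=
  if a = ∞ then driftAtInfty μ else μ a.toReal

variable {Ω : Type*}

/-- Coupled Brownian motions started from zero: `X_t(0) = 0` and
`X_t(a) = σ B_t - μ(a) t` for `a ∈ (0, ∞]`. -/
def X (σ : ℝ) (μ : ℝ → ℝ) (B : ℝ≥0 → Ω → ℝ) (t : ℝ≥0) (a : ℝ≥0∞) (ω : Ω) : ℝ :=
  if a = 0 then 0 else σ * B t ω - driftExt μ a * t

/-- The maximum process `M_*(a) = sup_{t ≥ 0} X_t(a)`. -/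
def Mstar (σ : ℝ) (μ : ℝ → ℝ) (B : ℝ≥0 → Ω → ℝ) (a : ℝ≥0∞) (ω : Ω) : ℝ :=
  ⨆ t : ℝ≥0, X σ μ B t a ω

/-- The one-dimensional Skorokhod map `Ψ[f](t) = f(t) - (inf_{0 ≤ s ≤ t} f(s)) ∧ 0`. -/
def skorokhodMap (f : ℝ≥0 → ℝ) (t : ℝ≥0) : ℝ :=
  f t - min (sInf (f '' Icc 0 t)) 0

/-- `w(∞) = lim_{a → ∞} w(a)`, in `[0, ∞]`. -/
def initAtInfty (w : ℝ≥0 → Ω → ℝ≥0) (ω : Ω) : ℝ≥0∞ :=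
  limUnder atTop (fun a : ℝ≥0 => (w a ω : ℝ≥0∞))

/-- The initial condition extended to `[0, ∞]`. -/
def initExt (w : ℝ≥0 → Ω → ℝ≥0) (a : ℝ≥0∞) (ω : Ω) : ℝ :=
  if a = ∞ then (initAtInfty w ω).toReal else (w a.toNNReal ω : ℝ)

/-- The finite initial conditions: continuous nondecreasing processes `w`, independent of `B`,
with `w(0) = 0`, `E ∫₀¹ w(a) / a² da < ∞` and `E w(∞) < ∞`. -/
structure IsFiniteInitialCondition [MeasurableSpace Ω] (P : Measure Ω) (B : ℝ≥0 → Ω → ℝ)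
    (w : ℝ≥0 → Ω → ℝ≥0) : Prop where
  aemeasurable : ∀ a, AEMeasurable (w a) P
  indep : IndepFun (fun ω a => w a ω) (fun ω t => B t ω) P
  continuous : ∀ᵐ ω ∂P, Continuous fun a => w a ω
  monotone : ∀ᵐ ω ∂P, Monotone fun a => w a ω
  zero : ∀ᵐ ω ∂P, w 0 ω = 0
  lintegral_lt_top :
    (∫⁻ ω, (∫⁻ a in Ioc (0 : ℝ) 1, ENNReal.ofReal (w a.toNNReal ω / a ^ 2)) ∂P) < ∞
  lintegral_infty_lt_top : (∫⁻ ω, initAtInfty w ω ∂P) < ∞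

/-- `χ_t(a) = w(a) + X_t(a)`. -/
def chi (σ : ℝ) (μ : ℝ → ℝ) (B : ℝ≥0 → Ω → ℝ) (w : ℝ≥0 → Ω → ℝ≥0)
    (t : ℝ≥0) (a : ℝ≥0∞) (ω : Ω) : ℝ :=
  initExt w a ω + X σ μ B t a ω

/-- Reflecting coupled Brownian motions `W_t(a) = Ψ[χ_·(a)](t)`, for `a ∈ [0, ∞]`. -/
def W (σ : ℝ) (μ : ℝ → ℝ) (B : ℝ≥0 → Ω → ℝ) (w : ℝ≥0 → Ω → ℝ≥0)
    (t : ℝ≥0) (a : ℝ≥0∞) (ω : Ω) : ℝ :=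
  skorokhodMap (fun s => chi σ μ B w s a ω) t

/-- The restriction to `[0, ∞)` of a function on `[0, ∞]`, as an element of the space `C(ℝ₊)`
(with the topology of uniform convergence on compact sets). The default value `0` is used only
where the restriction is not continuous. -/
def toPath (f : ℝ≥0∞ → ℝ) : C(ℝ≥0, ℝ) :=
  open scoped Classical in
  if h : Continuous (fun a : ℝ≥0 => f a) then ⟨fun a : ℝ≥0 => f a, h⟩ else 0

/-- `ζ` is the measure associated with `f`: `ζ{0} = 0`,
`ζ[0, a] = ∫₀ᵃ f(x) / x² dx + f(a) / a` for `a ∈ (0, ∞)`, and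
`ζ[0, ∞) = ∫₀^∞ f(x) / x² dx`. -/
structure IsAssociatedMeasure (f : ℝ≥0∞ → ℝ) (ζ : FiniteMeasure ℝ≥0) : Prop where
  zero : (ζ : Measure ℝ≥0) {0} = 0
  Icc : ∀ a : ℝ≥0, 0 < a → (ζ : Measure ℝ≥0) (Set.Icc 0 a) =
    (∫⁻ x in Ioc (0 : ℝ) a, ENNReal.ofReal (f (ENNReal.ofReal x) / x ^ 2))
      + ENNReal.ofReal (f a / a)
  univ : (ζ : Measure ℝ≥0) Set.univ =
    ∫⁻ x in Ioi (0 : ℝ), ENNReal.ofReal (f (ENNReal.ofReal x) / x ^ 2)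

/-- The finite measure associated with `f`; the default value `0` is used only where there is
none. -/
def associatedMeasure (f : ℝ≥0∞ → ℝ) : FiniteMeasure ℝ≥0 :=
  open scoped Classical in
  if h : ∃ ζ, IsAssociatedMeasure f ζ then h.choose else 0

/-- Convergence in distribution, as `t → ∞`, of random elements of a topological space `S`
equipped with its Borel σ-algebra. -/
def ConvergesInDistribution [MeasurableSpace Ω] (P : Measure Ω) [IsProbabilityMeasure P]
    {S : Type*} [TopologicalSpace S] (Y : ℝ≥0 → Ω → S) (Y' : Ω → S) : Prop :=
  letI : MeasurableSpace S := borel S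
  haveI : BorelSpace S := ⟨rfl⟩
  TendstoInDistribution Y atTop Y' (fun _ => P) P

end RCBM

end

/-!
For fixed `t`, replace `B` by the Brownian motion `s ↦ B_t - B_{t - s}` on `[0, t]`. Since `w` is
independent of `B`, this shows that `W_t(·)` has the law of
`Wrev_t(a) = max (sup_{s ≤ t} X_s(a)) (w(a) + X_t(a))`. Almost surely `B_t / t → 0`, so that for
`a ≤ c` the second term is eventually negative while the supremum defining `M_*(a)` is attained
before a time that depends only on `c`. Hence `Wrev_t = M_*` on `[0, c]` for all large `t`, which
turns the convergence in distribution of `W_t` into almost sure convergence of `Wrev_t`; if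
`μ(∞) > 0`, then `c = ∞` is allowed.

The measure associated with `f` is `x⁻¹ df(x)`, which depends measurably on `f`. The masses which
`Wrev_t` and `M_*` put near infinity are dominated by an integral of `(M_*(x) + w(x)) / x²`, so the
local equality of the functions yields convergence of the associated measures. This integral is
finite since Doob's maximal inequality for `exp (θ B_t - θ² t / 2)` gives
`E M_*(a) ≤ σ² / (2 μ(a))`.
-/

noncomputable section

namespace RCBM

section FiniteMeasure

open TopologicalSpace

variable {E : Type*} [MeasurableSpace E]

lemma measurable_finiteMeasure_apply {A : Set E} (hA : MeasurableSet A) :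
    Measurable fun ζ : FiniteMeasure E => ζ A :=
  ((Measure.measurable_coe hA).comp measurable_subtype_coe).ennreal_toNNReal

lemma finiteMeasure_map_simpleFunc {F : Type*} [MeasurableSpace F] [MeasurableSingletonClass F]
    (ζ : FiniteMeasure E) (s : SimpleFunc E F) :
    ζ.map s = ∑ y ∈ s.range, ζ (s ⁻¹' {y}) • (diracProba y).toFiniteMeasure := by
  apply FiniteMeasure.toMeasure_injective
  have hmem : ∀ᵐ x ∂(ζ : Measure E), s x ∈ s.range := .of_forall s.mem_range_self
  rw [FiniteMeasure.toMeasure_map,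
    (Measure.ae_mem_finset_iff_map_eq_sum_dirac s.measurable.aemeasurable).1 hmem]
  simp only [FiniteMeasure.toMeasure_sum, FiniteMeasure.toMeasure_smul, ENNReal.smul_def,
    FiniteMeasure.ennreal_coeFn_eq_coeFn_toMeasure]
  rfl

variable [TopologicalSpace E]

lemma tendsto_of_tendsto_add_finiteMeasure [OpensMeasurableSpace E] {ι : Type*} {l : Filter ι}
    {ζ : ι → FiniteMeasure E} {η θ : FiniteMeasure E}
    (h : Tendsto (fun i => ζ i + θ) l (𝓝 (η + θ))) : Tendsto ζ l (𝓝 η) := by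
  rw [FiniteMeasure.tendsto_iff_forall_lintegral_tendsto] at h ⊢
  intro f
  have hθ : ∫⁻ x, f x ∂(θ : Measure E) ≠ ∞ :=
    (f.lintegral_lt_top_of_nnreal (θ : Measure E)).ne
  simpa [lintegral_add_measure, ENNReal.add_sub_cancel_right hθ] using
    ENNReal.Tendsto.sub (h f) tendsto_const_nhds (.inr hθ)

/-- The total mass of a finite measure together with a probability measure which, given the mass,
determines it. Adding a Dirac mass before normalizing makes this continuous at the zero measure. -/
def massNormalize (x₀ : E) (ζ : FiniteMeasure E) : ℝ≥0 × ProbabilityMeasure E :=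
  haveI : Nonempty E := ⟨x₀⟩
  (ζ.mass, (ζ + (diracProba x₀).toFiniteMeasure).normalize)

lemma isInducing_massNormalize [OpensMeasurableSpace E] (x₀ : E) :
    IsInducing (massNormalize x₀) := by
  have : Nonempty E := ⟨x₀⟩
  set δ := (diracProba x₀).toFiniteMeasure
  have mass_add (ζ : FiniteMeasure E) : (ζ + δ).mass = ζ.mass + δ.mass := by
    simp only [FiniteMeasure.mass, FiniteMeasure.coeFn_add, Pi.add_apply]
  have ne_zero (ζ : FiniteMeasure E) : ζ + δ ≠ 0 := by
    rw [← FiniteMeasure.mass_nonzero_iff, mass_add]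
    simp [δ]
  refine isInducing_iff_nhds.2 fun η => le_antisymm ?_ ?_
  · refine tendsto_iff_comap.1 (Tendsto.prodMk_nhds ?_ ?_)
    · exact FiniteMeasure.continuous_mass.continuousAt
    · exact FiniteMeasure.tendsto_normalize_of_tendsto
        (continuous_add_const δ).continuousAt (ne_zero η)
  · have h : Tendsto (massNormalize x₀) (comap (massNormalize x₀) (𝓝 (massNormalize x₀ η)))
        (𝓝 (massNormalize x₀ η)) := tendsto_comap
    refine tendsto_of_tendsto_add_finiteMeasure (θ := δ) (ζ := id) <|
      FiniteMeasure.tendsto_of_tendsto_normalize_testAgainstNN_of_tendsto_mass h.snd_nhds ?_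
    simpa only [mass_add] using! h.fst_nhds.add_const δ.mass

lemma pseudoMetrizableSpace_finiteMeasure [PseudoMetrizableSpace E] [SeparableSpace E]
    [OpensMeasurableSpace E] : PseudoMetrizableSpace (FiniteMeasure E) := by
  rcases isEmpty_or_nonempty E with h | ⟨⟨x₀⟩⟩
  · have : Subsingleton (FiniteMeasure E) := FiniteMeasure.toMeasure_injective.subsingleton
    exact (IsInducing.of_subsingleton (fun _ : FiniteMeasure E => ())).pseudoMetrizableSpace
  · exact (isInducing_massNormalize x₀).pseudoMetrizableSpace

lemma tendsto_finiteMeasure_map [OpensMeasurableSpace E] (ζ : FiniteMeasure E) {s : ℕ → E → E}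
    (hs : ∀ n, Measurable (s n)) (hlim : ∀ x, Tendsto (s · x) atTop (𝓝 x)) :
    Tendsto (fun n => ζ.map (s n)) atTop (𝓝 ζ) := by
  refine FiniteMeasure.tendsto_iff_forall_integral_tendsto.2 fun f => ?_
  have hmap (n : ℕ) : ∫ x, f x ∂(ζ.map (s n) : Measure E) = ∫ x, f (s n x) ∂(ζ : Measure E) :=
    integral_map (hs n).aemeasurable f.continuous.measurable.aestronglyMeasurable
  simp only [hmap]
  refine tendsto_integral_of_dominated_convergence (fun _ => ‖f‖)
    (fun n => (f.continuous.measurable.comp (hs n)).aestronglyMeasurable) (integrable_const _)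
    (fun n => .of_forall fun x => f.norm_coe_le_norm _) (.of_forall fun x => ?_)
  exact (f.continuous.tendsto x).comp (hlim x)

lemma measurable_of_continuous_finiteMeasure [MetrizableSpace E] [SeparableSpace E]
    [OpensMeasurableSpace E] {S : Type*} [TopologicalSpace S] [PseudoMetrizableSpace S]
    [MeasurableSpace S] [BorelSpace S] {φ : FiniteMeasure E → S} (hφ : Continuous φ) :
    Measurable φ := by
  rcases isEmpty_or_nonempty E with h | ⟨⟨x₀⟩⟩
  · have : Subsingleton (FiniteMeasure E) := FiniteMeasure.toMeasure_injective.subsingleton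
    exact Subsingleton.measurable
  let _ : PseudoMetricSpace E := pseudoMetrizableSpacePseudoMetric E
  -- The image of `ζ` under a simple function is a finite combination of Dirac masses.
  let s (n : ℕ) : SimpleFunc E E := SimpleFunc.approxOn id measurable_id univ x₀ (mem_univ _) n
  have hs (x : E) : Tendsto (fun n => s n x) atTop (𝓝 x) :=
    SimpleFunc.tendsto_approxOn measurable_id (mem_univ _) (by simp)
  refine measurable_of_tendsto_metrizable (f := fun n ζ => φ (ζ.map (s n))) (fun n => ?_)
    (tendsto_pi_nhds.2 fun ζ => ?_)
  swap
  · exact Tendsto.comp (hφ.tendsto ζ)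
      (tendsto_finiteMeasure_map ζ (fun n => (s n).measurable) hs)
  have hc : Continuous fun c : (s n).range → ℝ≥0 =>
      φ (∑ y, c y • (diracProba (y : E)).toFiniteMeasure) := by fun_prop
  have hm : Measurable fun (ζ : FiniteMeasure E) (y : (s n).range) => ζ (s n ⁻¹' {(y : E)}) :=
    measurable_pi_lambda _ fun y => measurable_finiteMeasure_apply ((s n).measurableSet_fiber _)
  convert hc.measurable.comp hm using 2 with ζ
  rw [finiteMeasure_map_simpleFunc, ← Finset.sum_coe_sort]
  rfl

instance opensMeasurableSpace_finiteMeasure [MetrizableSpace E] [SeparableSpace E]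
    [OpensMeasurableSpace E] : OpensMeasurableSpace (FiniteMeasure E) := by
  have := pseudoMetrizableSpace_finiteMeasure (E := E)
  let _ : PseudoMetricSpace (FiniteMeasure E) := pseudoMetrizableSpacePseudoMetric _
  refine opensMeasurableSpace_iff_forall_measurableSet.2 fun U hU => ?_
  have hU' : U = (fun ζ => Metric.infEDist ζ Uᶜ) ⁻¹' {0}ᶜ := by
    ext ζ
    simpa using (Metric.mem_iff_infEDist_zero_of_closed hU.isClosed_compl (x := ζ)).not
  rw [hU']
  exact measurable_of_continuous_finiteMeasure Metric.continuous_infEDist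
    (measurableSet_singleton 0).compl

lemma tendsto_finiteMeasure_of_eventually_restrict_eq [OpensMeasurableSpace E] {ι : Type*}
    {l : Filter ι} {ζ : ι → FiniteMeasure E} {η : FiniteMeasure E} {s : ℕ → Set E}
    (hs : ∀ n, MeasurableSet (s n)) (hmono : Monotone s) (hunion : ⋃ n, s n = univ)
    (hloc : ∀ n, ∀ᶠ i in l, (ζ i).restrict (s n) = η.restrict (s n))
    (hmass : Tendsto (fun i => (ζ i).mass) l (𝓝 η.mass)) : Tendsto ζ l (𝓝 η) := by
  refine FiniteMeasure.tendsto_iff_forall_integral_tendsto.2 fun f => ?_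
  have hloc' (n : ℕ) :
      ∀ᶠ i in l, (ζ i : Measure E).restrict (s n) = (η : Measure E).restrict (s n) :=
    (hloc n).mono fun i hi => congrArg Subtype.val hi
  have tail_bound (θ : FiniteMeasure E) (n : ℕ) :
      ‖∫ x in (s n)ᶜ, f x ∂(θ : Measure E)‖ ≤ ‖f‖ * (θ : Measure E).real (s n)ᶜ :=
    norm_setIntegral_le_of_norm_le_const (measure_lt_top _ _) fun x _ => f.norm_coe_le_norm x
  have hmass' : Tendsto (fun i => (ζ i : Measure E).real univ) l (𝓝 ((η : Measure E).real univ)) :=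
    NNReal.tendsto_coe.2 hmass
  have htail (n : ℕ) : Tendsto (fun i => (ζ i : Measure E).real (s n)ᶜ) l
      (𝓝 ((η : Measure E).real (s n)ᶜ)) := by
    simp only [measureReal_compl (hs n)]
    refine hmass'.sub (tendsto_const_nhds.congr' ?_)
    filter_upwards [hloc' n] with i hi
    simpa using congrArg (·.real univ) hi.symm
  have hsmall : Tendsto (fun n => ‖f‖ * (2 * (η : Measure E).real (s n)ᶜ)) atTop (𝓝 0) := by
    have := tendsto_measure_iInter_atTop (μ := (η : Measure E))
      (fun n => (hs n).compl.nullMeasurableSet) (fun m n hmn => compl_subset_compl.2 (hmono hmn))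
      ⟨0, measure_ne_top _ _⟩
    rw [← compl_iUnion, hunion, compl_univ, measure_empty] at this
    simpa [Measure.real] using
      (((ENNReal.tendsto_toReal ENNReal.zero_ne_top).comp this).const_mul 2).const_mul ‖f‖
  refine Metric.tendsto_nhds.2 fun ε hε => ?_
  obtain ⟨n, hn⟩ := (hsmall.eventually_lt_const hε).exists
  have hlim : Tendsto
      (fun i => ‖f‖ * ((ζ i : Measure E).real (s n)ᶜ + (η : Measure E).real (s n)ᶜ)) l
      (𝓝 (‖f‖ * (2 * (η : Measure E).real (s n)ᶜ))) := by
    simpa [two_mul] using ((htail n).add_const ((η : Measure E).real (s n)ᶜ)).const_mul ‖f‖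
  filter_upwards [hlim.eventually_lt_const hn, hloc' n] with i hi hi'
  rw [← integral_add_compl (hs n) (f.integrable (ζ i : Measure E)),
    ← integral_add_compl (hs n) (f.integrable (η : Measure E)), hi', dist_add_left, mul_add] at *
  rw [dist_eq_norm]
  exact ((norm_sub_le _ _).trans (add_le_add (tail_bound _ n) (tail_bound _ n))).trans_lt hi

end FiniteMeasure

section IdentDistrib

variable {α β S T : Type*} [MeasurableSpace α] [MeasurableSpace β] [MeasurableSpace S]
  [MeasurableSpace T] {P : Measure α} {Q : Measure β}

lemma identDistrib_of_comp_measurableEmbedding {φ : S → T} (hφ : MeasurableEmbedding φ)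
    {Y : α → S} {Z : β → S} (h : IdentDistrib (φ ∘ Y) (φ ∘ Z) P Q) : IdentDistrib Y Z P Q := by
  have hY := hφ.aemeasurable_comp_iff.1 h.aemeasurable_fst
  have hZ := hφ.aemeasurable_comp_iff.1 h.aemeasurable_snd
  refine ⟨hY, hZ, hφ.map_injective ?_⟩
  rw [AEMeasurable.map_map_of_aemeasurable hφ.measurable.aemeasurable hY,
    AEMeasurable.map_map_of_aemeasurable hφ.measurable.aemeasurable hZ, h.map_eq]

lemma identDistrib_congr {Y Y' : α → S} {Z Z' : β → S} (h : IdentDistrib Y Z P Q)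
    (hY : Y =ᵐ[P] Y') (hZ : Z =ᵐ[Q] Z') : IdentDistrib Y' Z' P Q :=
  ((IdentDistrib.of_ae_eq h.aemeasurable_fst hY).symm.trans h).trans
    (IdentDistrib.of_ae_eq h.aemeasurable_snd hZ)

lemma tendstoInDistribution_of_identDistrib_of_ae_tendsto [IsProbabilityMeasure P]
    [TopologicalSpace S] [OpensMeasurableSpace S] {ι : Type*} {l : Filter ι}
    [l.IsCountablyGenerated] {Y Y' : ι → α → S} {Z : α → S}
    (h : ∀ i, IdentDistrib (Y i) (Y' i) P P) (hZ : AEMeasurable Z P)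
    (hlim : ∀ᵐ ω ∂P, Tendsto (Y' · ω) l (𝓝 (Z ω))) :
    TendstoInDistribution Y l Z (fun _ => P) P where
  forall_aemeasurable i := (h i).aemeasurable_fst
  aemeasurable_limit := hZ
  tendsto := (tendstoInDistribution_of_ae_tendsto (fun i => (h i).aemeasurable_snd) hZ
    hlim).tendsto.congr fun i => Subtype.ext (h i).map_eq.symm

lemma convergesInDistribution_of_identDistrib [IsProbabilityMeasure P]
    [TopologicalSpace S] [OpensMeasurableSpace S] {Y Y' : ℝ≥0 → α → S} {Z : α → S}
    (h : ∀ t, IdentDistrib (Y t) (Y' t) P P) (hZ : AEMeasurable Z P)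
    (hlim : ∀ᵐ ω ∂P, Tendsto (Y' · ω) atTop (𝓝 (Z ω))) :
    ConvergesInDistribution P Y Z := by
  -- The σ-algebra given on `S` may be strictly finer than the Borel one of the definition.
  have hid : Measurable[_, borel S] (id : S → S) :=
    fun s hs => OpensMeasurableSpace.borel_le s hs
  have h' (t : ℝ≥0) := @IdentDistrib.comp _ _ _ _ _ _ _ (borel S) _ _ _ _ _ (h t) hid
  have hZ' := @Measurable.comp_aemeasurable _ _ _ _ (borel S) _ _ _ _ hid hZ
  let : MeasurableSpace S := borel S
  have : BorelSpace S := ⟨rfl⟩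
  exact tendstoInDistribution_of_identDistrib_of_ae_tendsto h' hZ' hlim

end IdentDistrib

section RandomPaths

variable {Ω : Type*} [MeasurableSpace Ω] {P : Measure Ω}

instance instMeasurableSpacePath : MeasurableSpace C(ℝ≥0, ℝ) := borel _

instance instBorelSpacePath : BorelSpace C(ℝ≥0, ℝ) := ⟨rfl⟩

/-- The values of a path on a countable dense set, paired with an additional number which stands
for the value at `∞`. -/
def evalDense (p : C(ℝ≥0, ℝ) × ℝ) : (ℕ → ℝ) × ℝ :=
  (fun n => p.1 (TopologicalSpace.denseSeq ℝ≥0 n), p.2)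

lemma measurableEmbedding_evalDense : MeasurableEmbedding evalDense := by
  refine Continuous.measurableEmbedding (by unfold evalDense; fun_prop) ?_
  rintro ⟨f, x⟩ ⟨g, y⟩ h
  obtain ⟨hfg, hxy⟩ := Prod.mk.inj h
  exact Prod.ext (DFunLike.coe_injective <|
    (TopologicalSpace.denseRange_denseSeq ℝ≥0).equalizer f.continuous g.continuous hfg) hxy

lemma toPath_apply {f : ℝ≥0∞ → ℝ} (hf : Continuous fun a : ℝ≥0 => f a) (a : ℝ≥0) :
    toPath f a = f a := by
  simp [toPath, hf]

/-- The values of a function on `[0, ∞]` at countably many points, `∞` included. -/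
def denseValues (f : ℝ≥0∞ → ℝ) : (ℕ → ℝ) × ℝ :=
  (fun n => f (TopologicalSpace.denseSeq ℝ≥0 n), f ∞)

lemma evalDense_toPath {f : ℝ≥0∞ → ℝ} (hf : Continuous fun a : ℝ≥0 => f a) :
    evalDense (toPath f, f ∞) = denseValues f := by
  simp only [evalDense, denseValues, toPath_apply hf]

lemma aemeasurable_toPath {f : Ω → ℝ≥0∞ → ℝ} (hm : ∀ a : ℝ≥0, AEMeasurable (f · a) P)
    (hc : ∀ᵐ ω ∂P, Continuous fun a : ℝ≥0 => f ω a) :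
    AEMeasurable (fun ω => toPath (f ω)) P := by
  suffices h : AEMeasurable (fun ω => (toPath (f ω), (0 : ℝ))) P from h.fst
  rw [← measurableEmbedding_evalDense.aemeasurable_comp_iff]
  refine AEMeasurable.prodMk (aemeasurable_pi_lambda _ fun n => ?_) aemeasurable_const
  exact (hm _).congr (hc.mono fun ω hω => (toPath_apply hω _).symm)

lemma identDistrib_toPath_prodMk {f g : Ω → ℝ≥0∞ → ℝ}
    (h : IdentDistrib (fun ω => denseValues (f ω)) (fun ω => denseValues (g ω)) P P)
    (hf : ∀ᵐ ω ∂P, Continuous fun a : ℝ≥0 => f ω a)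
    (hg : ∀ᵐ ω ∂P, Continuous fun a : ℝ≥0 => g ω a) :
    IdentDistrib (fun ω => (toPath (f ω), f ω ∞)) (fun ω => (toPath (g ω), g ω ∞)) P P :=
  identDistrib_of_comp_measurableEmbedding measurableEmbedding_evalDense <|
    identDistrib_congr h (hf.mono fun _ hω => (evalDense_toPath hω).symm)
      (hg.mono fun _ hω => (evalDense_toPath hω).symm)

end RandomPaths

section InvDensity

lemma lintegral_Ioi_inv_sq {x : ℝ} (hx : 0 < x) :
    ∫⁻ y in Ioi x, ENNReal.ofReal (y ^ 2)⁻¹ = ENNReal.ofReal x⁻¹ := by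
  have hpow (y : ℝ) : (y ^ 2)⁻¹ = y ^ (-2 : ℝ) := by norm_cast
  simp only [hpow]
  rw [← ofReal_integral_eq_lintegral_ofReal (integrableOn_Ioi_rpow_of_lt (by norm_num) hx)
      ((ae_restrict_mem measurableSet_Ioi).mono fun y hy => Real.rpow_nonneg (hx.trans hy).le _),
    integral_Ioi_rpow_of_lt (by norm_num) hx]
  norm_num [Real.rpow_neg_one]

lemma setLIntegral_inv_eq_lintegral_measure (ν : Measure ℝ) [SFinite ν] {s : Set ℝ}
    (hs : MeasurableSet s) (hpos : s ⊆ Ioi 0) :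
    ∫⁻ x in s, ENNReal.ofReal x⁻¹ ∂ν
      = ∫⁻ y in Ioi 0, ENNReal.ofReal (y ^ 2)⁻¹ * ν (s ∩ Iic y) := by
  calc ∫⁻ x in s, ENNReal.ofReal x⁻¹ ∂ν
      = ∫⁻ x in s, (∫⁻ y in Ioi 0, (Ici x).indicator (fun y => ENNReal.ofReal (y ^ 2)⁻¹) y) ∂ν := by
        refine setLIntegral_congr_fun hs fun x hx => ?_
        have hx0 : 0 < x := hpos hx
        rw [setLIntegral_indicator measurableSet_Ici,
          inter_eq_left.2 (Ici_subset_Ioi.2 hx0),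
          ← setLIntegral_congr Ioi_ae_eq_Ici, lintegral_Ioi_inv_sq hx0]
    _ = ∫⁻ y in Ioi 0, (∫⁻ x in s, (Ici x).indicator (fun y => ENNReal.ofReal (y ^ 2)⁻¹) y ∂ν) := by
        refine lintegral_lintegral_swap (Measurable.aemeasurable ?_)
        exact Measurable.indicator (s := {p : ℝ × ℝ | p.1 ≤ p.2})
          (f := fun p => ENNReal.ofReal (p.2 ^ 2)⁻¹) (by fun_prop)
          (measurableSet_le measurable_fst measurable_snd)
    _ = ∫⁻ y in Ioi 0, ENNReal.ofReal (y ^ 2)⁻¹ * ν (s ∩ Iic y) := by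
        congr with y
        rw [inter_comm, ← Measure.restrict_apply measurableSet_Iic,
          ← lintegral_indicator_const measurableSet_Iic]
        rfl

end InvDensity

section Associated

/-- The functions to which a measure is associated: continuous and nondecreasing on `[0, ∞)`,
vanishing at `0`, with `f(x) / x²` integrable. -/
structure IsAdmissible (f : ℝ≥0∞ → ℝ) : Prop where
  continuous : Continuous fun a : ℝ≥0 => f a
  monotone : Monotone fun a : ℝ≥0 => f a
  zero : f 0 = 0
  lintegral_lt_top : (∫⁻ x in Ioi (0 : ℝ), ENNReal.ofReal (f (ENNReal.ofReal x) / x ^ 2)) < ∞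

variable {f g : ℝ≥0∞ → ℝ}

namespace IsAdmissible

lemma continuous_ofReal (hf : IsAdmissible f) : Continuous fun x : ℝ => f (ENNReal.ofReal x) :=
  hf.continuous.comp continuous_real_toNNReal

/-- The Stieltjes function `x ↦ f(x)`, equal to `0` on the negative half-line. -/
def stieltjes (hf : IsAdmissible f) : StieltjesFunction ℝ where
  toFun x := f (ENNReal.ofReal x)
  mono' _ _ hxy := hf.monotone (Real.toNNReal_le_toNNReal hxy)
  right_continuous' _ := hf.continuous_ofReal.continuousWithinAt

lemma stieltjes_measure_Ioc_zero (hf : IsAdmissible f) (a : ℝ) :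
    hf.stieltjes.measure (Ioc 0 a) = ENNReal.ofReal (f (ENNReal.ofReal a)) := by
  rw [StieltjesFunction.measure_Ioc]
  simp [stieltjes, hf.zero]

/-- The measure `x⁻¹ df(x)` on `[0, ∞)`. -/
def invMeasure (hf : IsAdmissible f) : Measure ℝ≥0 :=
  ((hf.stieltjes.measure.restrict (Ioi 0)).withDensity fun x => ENNReal.ofReal x⁻¹).map
    Real.toNNReal

lemma invMeasure_apply (hf : IsAdmissible f) {s : Set ℝ≥0} (hs : MeasurableSet s) :
    hf.invMeasure s = ∫⁻ y in Ioi 0, ENNReal.ofReal (y ^ 2)⁻¹ *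
      hf.stieltjes.measure (Real.toNNReal ⁻¹' s ∩ Ioi 0 ∩ Iic y) := by
  have hs' := measurable_real_toNNReal hs
  rw [invMeasure, Measure.map_apply measurable_real_toNNReal hs, withDensity_apply _ hs',
    Measure.restrict_restrict hs',
    setLIntegral_inv_eq_lintegral_measure _ (hs'.inter measurableSet_Ioi) inter_subset_right]

lemma invMeasure_zero (hf : IsAdmissible f) : hf.invMeasure {0} = 0 := by
  have hempty : Real.toNNReal ⁻¹' {0} ∩ Ioi 0 = ∅ := by
    ext x
    simp
  simp [hf.invMeasure_apply (measurableSet_singleton 0), hempty]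

lemma invMeasure_Icc (hf : IsAdmissible f) {a : ℝ≥0} (ha : 0 < a) :
    hf.invMeasure (Icc 0 a) =
      (∫⁻ x in Ioc (0 : ℝ) a, ENNReal.ofReal (f (ENNReal.ofReal x) / x ^ 2))
        + ENNReal.ofReal (f a / a) := by
  have hpre (y : ℝ) : Real.toNNReal ⁻¹' Icc 0 a ∩ Ioi 0 ∩ Iic y = Ioc 0 (min (a : ℝ) y) := by
    ext x
    simp [Real.toNNReal_le_iff_le_coe, and_assoc, and_left_comm]
  simp only [hf.invMeasure_apply measurableSet_Icc, hpre, stieltjes_measure_Ioc_zero]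
  rw [← Ioc_union_Ioi_eq_Ioi a.coe_nonneg, lintegral_union measurableSet_Ioi
    (Ioc_disjoint_Ioi le_rfl)]
  congr 1
  · refine setLIntegral_congr_fun measurableSet_Ioc fun y hy => ?_
    simp only [min_eq_right hy.2]
    rw [← ENNReal.ofReal_mul (by positivity), inv_mul_eq_div]
  · rw [setLIntegral_congr_fun (g := fun y => ENNReal.ofReal (y ^ 2)⁻¹ * ENNReal.ofReal (f a))
      measurableSet_Ioi fun y (hy : (a : ℝ) < y) => by simp [min_eq_left hy.le],
      lintegral_mul_const' _ _ ENNReal.ofReal_ne_top, lintegral_Ioi_inv_sq (by exact_mod_cast ha),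
      ← ENNReal.ofReal_mul (by positivity), inv_mul_eq_div]

lemma invMeasure_univ (hf : IsAdmissible f) :
    hf.invMeasure univ = ∫⁻ x in Ioi (0 : ℝ), ENNReal.ofReal (f (ENNReal.ofReal x) / x ^ 2) := by
  rw [hf.invMeasure_apply .univ]
  congr with y
  rw [preimage_univ, univ_inter, Ioi_inter_Iic, hf.stieltjes_measure_Ioc_zero,
    ← ENNReal.ofReal_mul (by positivity), inv_mul_eq_div]

lemma exists_isAssociatedMeasure (hf : IsAdmissible f) : ∃ ζ, IsAssociatedMeasure f ζ :=
  ⟨⟨hf.invMeasure, ⟨hf.invMeasure_univ.trans_lt hf.lintegral_lt_top⟩⟩, hf.invMeasure_zero,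
    fun _ => hf.invMeasure_Icc, hf.invMeasure_univ⟩

end IsAdmissible

lemma finiteMeasure_ext_of_Icc {ζ η : FiniteMeasure ℝ≥0}
    (h : ∀ a, (ζ : Measure ℝ≥0) (Icc 0 a) = (η : Measure ℝ≥0) (Icc 0 a)) : ζ = η := by
  simp only [← bot_eq_zero, Icc_bot] at h
  exact FiniteMeasure.toMeasure_injective (Measure.ext_of_Iic _ _ h)

namespace IsAssociatedMeasure

variable {ζ η : FiniteMeasure ℝ≥0}

lemma measure_Icc_congr (hζ : IsAssociatedMeasure f ζ) (hη : IsAssociatedMeasure g η) {a : ℝ≥0}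
    (hfg : ∀ b : ℝ≥0, b ≤ a → f b = g b) :
    (ζ : Measure ℝ≥0) (Set.Icc 0 a) = (η : Measure ℝ≥0) (Set.Icc 0 a) := by
  rcases eq_zero_or_pos a with rfl | ha
  · rw [Icc_self, hζ.zero, hη.zero]
  · rw [hζ.Icc a ha, hη.Icc a ha, hfg a le_rfl]
    congr 1
    refine setLIntegral_congr_fun measurableSet_Ioc fun x hx => ?_
    simp only [ENNReal.ofReal, hfg x.toNNReal (Real.toNNReal_le_iff_le_coe.2 hx.2)]

lemma eq_of_forall_eq (hζ : IsAssociatedMeasure f ζ) (hη : IsAssociatedMeasure g η)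
    (hfg : ∀ a : ℝ≥0, f a = g a) : ζ = η :=
  finiteMeasure_ext_of_Icc fun _ => hζ.measure_Icc_congr hη fun b _ => hfg b

end IsAssociatedMeasure

lemma IsAdmissible.existsUnique (hf : IsAdmissible f) : ∃! ζ, IsAssociatedMeasure f ζ :=
  existsUnique_of_exists_of_unique hf.exists_isAssociatedMeasure fun _ _ h h' =>
    h.eq_of_forall_eq h' fun _ => rfl

lemma IsAdmissible.associatedMeasure_spec (hf : IsAdmissible f) :
    IsAssociatedMeasure f (associatedMeasure f) := by
  rw [associatedMeasure, dif_pos hf.exists_isAssociatedMeasure]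
  exact hf.exists_isAssociatedMeasure.choose_spec

end Associated

section PathMeasure

variable {f g : ℝ≥0∞ → ℝ}

lemma IsAdmissible.congr (hf : IsAdmissible f) (hfg : ∀ a : ℝ≥0, f a = g a) :
    IsAdmissible g where
  continuous := by simpa only [hfg] using hf.continuous
  monotone := by simpa only [hfg] using hf.monotone
  zero := by simpa [hf.zero] using (hfg 0).symm
  lintegral_lt_top := by simpa only [ENNReal.ofReal, hfg] using hf.lintegral_lt_top

/-- A path regarded as a function on `[0, ∞]`, with the value `g 0` at `∞`. -/
def extendPath (g : C(ℝ≥0, ℝ)) (a : ℝ≥0∞) : ℝ := g a.toNNReal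

lemma extendPath_toPath (hf : Continuous fun a : ℝ≥0 => f a) (a : ℝ≥0) :
    extendPath (toPath f) a = f a := by
  rw [extendPath, ENNReal.toNNReal_coe, toPath_apply hf]

open scoped Classical in
/-- The associated measure as a function of the path alone, defined to be `0` if the path is not
admissible. This makes it a measurable function of the path. -/
def pathMeasure (g : C(ℝ≥0, ℝ)) : FiniteMeasure ℝ≥0 :=
  if IsAdmissible (extendPath g) then associatedMeasure (extendPath g) else 0

lemma IsAdmissible.pathMeasure_toPath (hf : IsAdmissible f) :
    pathMeasure (toPath f) = associatedMeasure f := by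
  have hf' : IsAdmissible (extendPath (toPath f)) :=
    hf.congr fun a => (extendPath_toPath hf.continuous a).symm
  rw [pathMeasure, if_pos hf']
  exact hf'.associatedMeasure_spec.eq_of_forall_eq hf.associatedMeasure_spec
    (extendPath_toPath hf.continuous)

lemma measurable_density_path : Measurable fun p : C(ℝ≥0, ℝ) × ℝ =>
    ENNReal.ofReal (extendPath p.1 (ENNReal.ofReal p.2) / p.2 ^ 2) := by
  have heval : Continuous fun p : C(ℝ≥0, ℝ) × ℝ => p.1 p.2.toNNReal := by fun_prop
  exact (heval.measurable.div (measurable_snd.pow_const 2)).ennreal_ofReal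

lemma measurable_lintegral_path (s : Set ℝ) : Measurable fun g : C(ℝ≥0, ℝ) =>
    ∫⁻ x in s, ENNReal.ofReal (extendPath g (ENNReal.ofReal x) / x ^ 2) :=
  measurable_density_path.lintegral_prod_right' (ν := volume.restrict s)

lemma measurableSet_isAdmissible : MeasurableSet {g : C(ℝ≥0, ℝ) | IsAdmissible (extendPath g)} := by
  have e : {g : C(ℝ≥0, ℝ) | IsAdmissible (extendPath g)}
      = (⋂ (a : ℝ≥0) (b : ℝ≥0) (_ : a ≤ b), {g | g a ≤ g b}) ∩ {g | g 0 = 0} ∩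
        {g | (∫⁻ x in Ioi (0 : ℝ),
          ENNReal.ofReal (extendPath g (ENNReal.ofReal x) / x ^ 2)) < ∞} := by
    ext g
    simp only [mem_inter_iff, mem_iInter]
    exact ⟨fun h => ⟨⟨fun a b => @h.monotone a b, h.zero⟩, h.lintegral_lt_top⟩,
      fun h => ⟨g.continuous, h.1.1, h.1.2, h.2⟩⟩
  rw [e]
  refine (IsClosed.measurableSet ?_).inter
    (measurableSet_lt (measurable_lintegral_path _) measurable_const)
  exact (isClosed_iInter fun a => isClosed_iInter fun b => isClosed_iInter fun _ =>
    isClosed_le (by fun_prop) (by fun_prop)).inter (isClosed_eq (by fun_prop) continuous_const)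

lemma measurable_associatedMeasure_extendPath :
    Measurable fun g : {g | IsAdmissible (extendPath g)} => associatedMeasure (extendPath g) := by
  refine Measurable.subtype_mk (p := fun μ : Measure ℝ≥0 => IsFiniteMeasure μ)
    (f := fun g : {g | IsAdmissible (extendPath g)} =>
      (associatedMeasure (extendPath g) : Measure ℝ≥0))
    (h := fun g => (associatedMeasure (extendPath g)).2) ?_
  refine Measurable.measure_of_isPiSystem (borel_eq_generateFrom_Iic ℝ≥0 ▸
    BorelSpace.measurable_eq) (@isPiSystem_Iic ℝ≥0 _) ?_ ?_
  · rintro _ ⟨a, rfl⟩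
    rw [← Icc_bot, bot_eq_zero]
    rcases eq_zero_or_pos a with rfl | ha
    · simp only [Icc_self, fun g : {g | IsAdmissible (extendPath g)} =>
        g.2.associatedMeasure_spec.zero, measurable_const]
    · have heval : Continuous fun g : C(ℝ≥0, ℝ) => g a / (a : ℝ) := by fun_prop
      simp only [fun g : {g | IsAdmissible (extendPath g)} => g.2.associatedMeasure_spec.Icc a ha]
      exact ((measurable_lintegral_path _).add heval.measurable.ennreal_ofReal).comp
        measurable_subtype_coe
  · simp only [fun g : {g | IsAdmissible (extendPath g)} => g.2.associatedMeasure_spec.univ]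
    exact (measurable_lintegral_path _).comp measurable_subtype_coe

lemma measurable_pathMeasure : Measurable pathMeasure := by
  classical
  refine measurable_of_restrict_of_restrict_compl measurableSet_isAdmissible ?_ ?_
  · convert measurable_associatedMeasure_extendPath with g
    exact if_pos g.2
  · convert measurable_const (a := (0 : FiniteMeasure ℝ≥0)) with g
    exact if_neg g.2

lemma associatedMeasure_restrict_Iic_congr (hf : IsAdmissible f) (hg : IsAdmissible g) {c : ℝ≥0}
    (hfg : ∀ a : ℝ≥0, a ≤ c → f a = g a) :
    (associatedMeasure f).restrict (Iic c) = (associatedMeasure g).restrict (Iic c) := by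
  refine finiteMeasure_ext_of_Icc fun a => ?_
  have hIcc : Icc 0 a ∩ Iic c = Icc 0 (a ⊓ c) := by
    ext
    simp
  simp only [FiniteMeasure.restrict_measure_eq, Measure.restrict_apply measurableSet_Icc, hIcc]
  exact hf.associatedMeasure_spec.measure_Icc_congr hg.associatedMeasure_spec fun b hb =>
    hfg b (hb.trans inf_le_right)

lemma tendsto_associatedMeasure {ι : Type*} {l : Filter ι} [l.IsCountablyGenerated]
    {F : ι → ℝ≥0∞ → ℝ} {bd : ℝ → ℝ≥0∞}
    (hF : ∀ i, IsAdmissible (F i)) (hf : IsAdmissible f)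
    (hloc : ∀ c : ℝ≥0, ∀ᶠ i in l, ∀ a : ℝ≥0, a ≤ c → F i a = f a)
    (hbd : ∀ i, ∀ x : ℝ, 0 < x → ENNReal.ofReal (F i (ENNReal.ofReal x) / x ^ 2) ≤ bd x)
    (hfin : (∫⁻ x in Ioi (0 : ℝ), bd x) ≠ ∞) :
    Tendsto (fun i => associatedMeasure (F i)) l (𝓝 (associatedMeasure f)) := by
  refine tendsto_finiteMeasure_of_eventually_restrict_eq (s := fun n : ℕ => Iic (n : ℝ≥0))
    (fun n => measurableSet_Iic) (fun m n hmn => Iic_subset_Iic.2 (by exact_mod_cast hmn)) ?_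
    (fun n => (hloc n).mono fun i hi => associatedMeasure_restrict_Iic_congr (hF i) hf hi) ?_
  · exact iUnion_eq_univ_iff.2 fun a => exists_nat_ge a
  · refine (ENNReal.tendsto_toNNReal (measure_ne_top _ _)).comp ?_
    simp only [(hF _).associatedMeasure_spec.univ, hf.associatedMeasure_spec.univ]
    refine tendsto_lintegral_filter_of_dominated_convergence bd
      (.of_forall fun i => ((hF i).continuous_ofReal.measurable.div (by fun_prop)).ennreal_ofReal)
      (.of_forall fun i => (ae_restrict_mem measurableSet_Ioi).mono (hbd i)) hfin ?_
    refine .of_forall fun x => tendsto_const_nhds.congr' ?_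
    filter_upwards [hloc x.toNNReal] with i hi
    simp only [ENNReal.ofReal, hi _ le_rfl]

end PathMeasure

section RandomDensity

variable {Ω : Type*} [MeasurableSpace Ω] {P : Measure Ω} {f : Ω → ℝ≥0∞ → ℝ}

lemma aemeasurable_lintegral_density (hm : ∀ a : ℝ≥0, AEMeasurable (f · a) P)
    (hc : ∀ᵐ ω ∂P, Continuous fun a : ℝ≥0 => f ω a) (s : Set ℝ) :
    AEMeasurable (fun ω => ∫⁻ x in s, ENNReal.ofReal (f ω (ENNReal.ofReal x) / x ^ 2)) P := by
  refine ((measurable_lintegral_path s).comp_aemeasurable (aemeasurable_toPath hm hc)).congr ?_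
  filter_upwards [hc] with ω hω
  simp only [Function.comp, ENNReal.ofReal, extendPath_toPath hω]

lemma ae_lintegral_density_lt_top [SFinite P] (hm : ∀ a : ℝ≥0, AEMeasurable (f · a) P)
    (hc : ∀ᵐ ω ∂P, Continuous fun a : ℝ≥0 => f ω a) {s : Set ℝ}
    (hfin : (∫⁻ x in s, ∫⁻ ω, ENNReal.ofReal (f ω (ENNReal.ofReal x) / x ^ 2) ∂P) < ∞) :
    ∀ᵐ ω ∂P, (∫⁻ x in s, ENNReal.ofReal (f ω (ENNReal.ofReal x) / x ^ 2)) < ∞ := by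
  refine ae_lt_top' (aemeasurable_lintegral_density hm hc s) (ne_of_lt ?_)
  rwa [lintegral_lintegral_swap]
  refine (measurable_density_path.comp_aemeasurable
    ((aemeasurable_toPath hm hc).comp_fst.prodMk measurable_snd.aemeasurable)).congr ?_
  filter_upwards [Measure.quasiMeasurePreserving_fst.ae hc] with p hp
  simp only [Function.comp, Function.uncurry, ENNReal.ofReal, extendPath_toPath hp]

end RandomDensity

section Pathwise

namespace IsDriftFunction

variable {μ : ℝ → ℝ}

lemma tendsto_driftAtInfty (hμ : IsDriftFunction μ) : Tendsto μ atTop (𝓝 (driftAtInfty μ)) := by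
  have ha : Antitone fun x : ℝ => μ (max x 1) := fun x y hxy =>
    hμ.strictAnti.antitoneOn (mem_Ioi.2 (lt_max_of_lt_right one_pos))
      (mem_Ioi.2 (lt_max_of_lt_right one_pos)) (max_le_max_right 1 hxy)
  have hb : BddBelow (range fun x : ℝ => μ (max x 1)) :=
    ⟨0, by rintro _ ⟨x, rfl⟩; exact (hμ.pos _ (lt_max_of_lt_right one_pos)).le⟩
  have h : Tendsto μ atTop (𝓝 (⨅ x : ℝ, μ (max x 1))) := by
    refine (tendsto_atTop_ciInf ha hb).congr' ?_
    filter_upwards [eventually_ge_atTop 1] with x hx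
    rw [max_eq_left hx]
  rw [driftAtInfty, h.limUnder_eq]
  exact h

lemma driftAtInfty_le (hμ : IsDriftFunction μ) {a : ℝ} (ha : 0 < a) : driftAtInfty μ ≤ μ a := by
  refine le_of_tendsto hμ.tendsto_driftAtInfty ?_
  filter_upwards [eventually_ge_atTop a] with x hx
  exact hμ.strictAnti.antitoneOn ha (ha.trans_le hx) hx

lemma driftExt_anti (hμ : IsDriftFunction μ) {a b : ℝ≥0∞} (ha : a ≠ 0) (hab : a ≤ b) :
    driftExt μ b ≤ driftExt μ a := by
  rcases eq_or_ne b ∞ with rfl | hb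
  · rcases eq_or_ne a ∞ with rfl | ha'
    · exact le_rfl
    · simpa [driftExt, ha'] using hμ.driftAtInfty_le (ENNReal.toReal_pos ha ha')
  · have ha' : a ≠ ∞ := ne_top_of_le_ne_top hb hab
    simp only [driftExt, ha', hb, if_false]
    exact hμ.strictAnti.antitoneOn (ENNReal.toReal_pos ha ha')
      ((ENNReal.toReal_pos ha ha').trans_le (ENNReal.toReal_mono hb hab))
      (ENNReal.toReal_mono hb hab)

lemma driftExt_coe (a : ℝ≥0) : driftExt μ a = μ a := by simp [driftExt]

lemma driftExt_infty : driftExt μ ∞ = driftAtInfty μ := if_pos rfl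

lemma driftExt_coe_pos (hμ : IsDriftFunction μ) {a : ℝ≥0} (ha : a ≠ 0) : 0 < driftExt μ a := by
  rw [driftExt_coe]
  exact hμ.pos _ (by positivity)

end IsDriftFunction

/-- A continuous path from the origin which stays bounded above after subtraction of any positive
linear drift: the only almost sure properties of Brownian paths entering the pathwise part. -/
structure IsDriftDominated (b : ℝ≥0 → ℝ) : Prop where
  continuous : Continuous b
  zero : b 0 = 0
  bddAbove : ∀ m : ℝ, 0 < m → BddAbove (range fun t : ℝ≥0 => b t - m * t)

variable {Ω : Type*} {σ : ℝ} {μ : ℝ → ℝ} {B : ℝ≥0 → Ω → ℝ} {w : ℝ≥0 → Ω → ℝ≥0} {ω : Ω}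

@[simp] lemma X_apply_zero (t : ℝ≥0) : X σ μ B t 0 ω = 0 := by simp [X]

lemma X_of_ne_zero {a : ℝ≥0∞} (ha : a ≠ 0) (t : ℝ≥0) :
    X σ μ B t a ω = σ * B t ω - driftExt μ a * t := by simp [X, ha]

lemma X_zero_time (hb : B 0 ω = 0) (a : ℝ≥0∞) : X σ μ B 0 a ω = 0 := by
  simp [X, hb]

lemma continuous_X (hb : Continuous fun t => B t ω) (a : ℝ≥0∞) :
    Continuous fun t => X σ μ B t a ω := by
  unfold X
  split_ifs
  · exact continuous_const
  · fun_prop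

lemma X_mono (hμ : IsDriftFunction μ) (t : ℝ≥0) {a c : ℝ≥0∞} (ha : a ≠ 0) (hac : a ≤ c) :
    X σ μ B t a ω ≤ X σ μ B t c ω := by
  rw [X_of_ne_zero ha, X_of_ne_zero (ne_bot_of_le_ne_bot ha hac)]
  have := hμ.driftExt_anti ha hac
  gcongr

lemma bddAbove_X (hb : IsDriftDominated fun t => B t ω) (hσ : 0 < σ) {a : ℝ≥0∞}
    (ha : a ≠ 0 → 0 < driftExt μ a) : BddAbove (range fun t => X σ μ B t a ω) := by
  rcases eq_or_ne a 0 with rfl | ha0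
  · simp [bddAbove_singleton]
  · obtain ⟨K, hK⟩ := hb.bddAbove (driftExt μ a / σ) (div_pos (ha ha0) hσ)
    refine ⟨σ * K, ?_⟩
    rintro _ ⟨t, rfl⟩
    have := hK ⟨t, rfl⟩
    dsimp only at this ⊢
    rw [X_of_ne_zero ha0]
    calc σ * B t ω - driftExt μ a * t = σ * (B t ω - driftExt μ a / σ * t) := by field_simp
      _ ≤ σ * K := by gcongr

lemma eventually_X_lt (hb : IsDriftDominated fun t => B t ω) (hσ : 0 < σ) {a : ℝ≥0∞} (ha : a ≠ 0)
    (hd : 0 < driftExt μ a) (x : ℝ) : ∀ᶠ t in atTop, X σ μ B t a ω < x := by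
  obtain ⟨K, hK⟩ := hb.bddAbove (driftExt μ a / (2 * σ)) (by positivity)
  have h : Tendsto (fun t : ℝ≥0 => driftExt μ a / 2 * (t : ℝ)) atTop atTop :=
    NNReal.tendsto_coe_atTop.2 tendsto_id |>.const_mul_atTop (by positivity)
  filter_upwards [h.eventually_gt_atTop (σ * K - x)] with t ht
  have := hK ⟨t, rfl⟩
  dsimp only at this
  rw [X_of_ne_zero ha]
  have e : σ * B t ω - driftExt μ a * t
      = σ * (B t ω - driftExt μ a / (2 * σ) * t) - driftExt μ a / 2 * t := by field_simp; ring
  have : σ * (B t ω - driftExt μ a / (2 * σ) * t) ≤ σ * K := by gcongr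
  linarith

/-- The running maximum `sup_{s ≤ t} X_s(a)`. -/
def runMax (σ : ℝ) (μ : ℝ → ℝ) (B : ℝ≥0 → Ω → ℝ) (t : ℝ≥0) (a : ℝ≥0∞) (ω : Ω) : ℝ :=
  sSup ((fun s => X σ μ B s a ω) '' Icc 0 t)

lemma le_runMax (hb : Continuous fun t => B t ω) {s t : ℝ≥0} (hst : s ≤ t) (a : ℝ≥0∞) :
    X σ μ B s a ω ≤ runMax σ μ B t a ω :=
  le_csSup (isCompact_Icc.image (continuous_X hb a)).bddAbove ⟨s, ⟨zero_le, hst⟩, rfl⟩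

lemma runMax_le {t : ℝ≥0} {a : ℝ≥0∞} {x : ℝ} (h : ∀ s ≤ t, X σ μ B s a ω ≤ x) :
    runMax σ μ B t a ω ≤ x :=
  csSup_le ⟨_, 0, ⟨le_rfl, zero_le⟩, rfl⟩ (by rintro _ ⟨s, hs, rfl⟩; exact h s hs.2)

lemma runMax_nonneg (hb : Continuous fun t => B t ω) (h0 : B 0 ω = 0) (t : ℝ≥0) (a : ℝ≥0∞) :
    0 ≤ runMax σ μ B t a ω :=
  (X_zero_time h0 a).ge.trans (le_runMax hb zero_le a)

lemma runMax_apply_zero (t : ℝ≥0) : runMax σ μ B t 0 ω = 0 := by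
  have : (Icc (0 : ℝ≥0) t).Nonempty := ⟨0, le_rfl, zero_le⟩
  simp [runMax, this]

lemma runMax_mono (hμ : IsDriftFunction μ) (hb : Continuous fun t => B t ω) (h0 : B 0 ω = 0)
    (t : ℝ≥0) : Monotone fun a => runMax σ μ B t a ω := by
  intro a c hac
  rcases eq_or_ne a 0 with rfl | ha
  · simp only [runMax_apply_zero]
    exact runMax_nonneg hb h0 t c
  · exact runMax_le fun s hs => (X_mono hμ s ha hac).trans (le_runMax hb hs c)

lemma le_Mstar (hb : IsDriftDominated fun t => B t ω) (hσ : 0 < σ) {a : ℝ≥0∞}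
    (ha : a ≠ 0 → 0 < driftExt μ a) (t : ℝ≥0) : X σ μ B t a ω ≤ Mstar σ μ B a ω :=
  le_ciSup (bddAbove_X hb hσ ha) t

lemma Mstar_le {a : ℝ≥0∞} {x : ℝ} (h : ∀ t, X σ μ B t a ω ≤ x) : Mstar σ μ B a ω ≤ x :=
  ciSup_le h

lemma Mstar_nonneg (h0 : B 0 ω = 0) (a : ℝ≥0∞) : 0 ≤ Mstar σ μ B a ω := by
  by_cases h : BddAbove (range fun t => X σ μ B t a ω)
  · exact (X_zero_time h0 a).ge.trans (le_ciSup h 0)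
  · exact (Real.iSup_of_not_bddAbove h).ge

@[simp] lemma Mstar_apply_zero : Mstar σ μ B 0 ω = 0 := by simp [Mstar]

lemma runMax_le_Mstar (hb : IsDriftDominated fun t => B t ω) (hσ : 0 < σ) {a : ℝ≥0∞}
    (ha : a ≠ 0 → 0 < driftExt μ a) (t : ℝ≥0) : runMax σ μ B t a ω ≤ Mstar σ μ B a ω :=
  runMax_le fun s _ => le_Mstar hb hσ ha s

lemma driftExt_pos_of_le (hμ : IsDriftFunction μ) {a c : ℝ≥0∞} (hd : 0 < driftExt μ c)
    (hac : a ≤ c) : a ≠ 0 → 0 < driftExt μ a :=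
  fun ha => hd.trans_le (hμ.driftExt_anti ha hac)

lemma eventually_runMax_eq (hμ : IsDriftFunction μ) (hb : IsDriftDominated fun t => B t ω)
    (hσ : 0 < σ) {c : ℝ≥0∞} (hc : c ≠ 0) (hd : 0 < driftExt μ c) :
    ∀ᶠ t in atTop, ∀ a ≤ c, runMax σ μ B t a ω = Mstar σ μ B a ω := by
  obtain ⟨T, hT⟩ := eventually_atTop.1 (eventually_X_lt (μ := μ) hb hσ hc hd 0)
  filter_upwards [eventually_ge_atTop T] with t ht a hac
  refine le_antisymm (runMax_le_Mstar hb hσ (driftExt_pos_of_le hμ hd hac) t)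
    (Mstar_le fun s => ?_)
  rcases eq_or_ne a 0 with rfl | ha
  · simp [runMax_apply_zero]
  rcases le_total s t with hst | hst
  · exact le_runMax hb.continuous hst a
  · exact ((X_mono hμ s ha hac).trans (hT s (ht.trans hst)).le).trans
      (runMax_nonneg hb.continuous hb.zero t a)

lemma runMax_le_add {t : ℝ≥0} {a c : ℝ≥0∞} (hb : Continuous fun t => B t ω) (ha : a ≠ 0)
    (hc : c ≠ 0) :
    runMax σ μ B t a ω ≤ runMax σ μ B t c ω + |driftExt μ a - driftExt μ c| * t := by
  refine runMax_le fun s hs => ?_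
  have h := le_runMax (σ := σ) (μ := μ) hb hs c
  rw [X_of_ne_zero hc] at h
  rw [X_of_ne_zero ha]
  have h1 : (driftExt μ c - driftExt μ a) * s ≤ |driftExt μ a - driftExt μ c| * s := by
    gcongr
    rw [abs_sub_comm]
    exact le_abs_self _
  have h2 : |driftExt μ a - driftExt μ c| * s ≤ |driftExt μ a - driftExt μ c| * t := by
    gcongr
  linarith

lemma continuousAt_driftExt (hμ : IsDriftFunction μ) {a : ℝ≥0} (ha : a ≠ 0) :
    ContinuousAt (fun c : ℝ≥0 => driftExt μ c) a := by
  simp only [IsDriftFunction.driftExt_coe]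
  have : ContinuousAt μ (a : ℝ) :=
    hμ.continuousOn.continuousAt (Ioi_mem_nhds (by positivity))
  exact this.comp NNReal.continuous_coe.continuousAt

lemma continuousAt_runMax (hμ : IsDriftFunction μ) (hb : Continuous fun t => B t ω) (t : ℝ≥0)
    {a : ℝ≥0} (ha : a ≠ 0) : ContinuousAt (fun c : ℝ≥0 => runMax σ μ B t c ω) a := by
  have h : Tendsto (fun c : ℝ≥0 => |driftExt μ c - driftExt μ a| * t) (𝓝 a) (𝓝 0) := by
    have := (((continuousAt_driftExt hμ ha).tendsto.sub_const (driftExt μ a)).abs).mul_const (t : ℝ)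
    simpa using this
  rw [ContinuousAt, tendsto_iff_dist_tendsto_zero]
  refine squeeze_zero' (.of_forall fun _ => dist_nonneg) ?_ h
  filter_upwards [isOpen_ne.mem_nhds ha] with c hc
  have ha' : (a : ℝ≥0∞) ≠ 0 := by exact_mod_cast ha
  have hc' : (c : ℝ≥0∞) ≠ 0 := by exact_mod_cast hc
  have h1 := runMax_le_add (σ := σ) (μ := μ) (t := t) hb ha' hc'
  have h2 := runMax_le_add (σ := σ) (μ := μ) (t := t) hb hc' ha'
  rw [abs_sub_comm (driftExt μ a)] at h1
  rw [Real.dist_eq, abs_le]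
  constructor <;> linarith

lemma IsDriftDominated.exists_forall_mul_sub_le {b : ℝ≥0 → ℝ} (hb : IsDriftDominated b)
    (hσ : 0 < σ) {ε : ℝ} (hε : 0 < ε) : ∃ m₀, ∀ m > m₀, ∀ t, σ * b t - m * t ≤ ε := by
  obtain ⟨K, hK⟩ := hb.bddAbove 1 one_pos
  have hsmall : ∀ᶠ t : ℝ≥0 in 𝓝 0, b t < ε / σ := by
    have : Tendsto b (𝓝 0) (𝓝 0) := by simpa [hb.zero] using hb.continuous.tendsto 0
    exact this.eventually_lt_const (by positivity)
  obtain ⟨δ, hδ, hδb⟩ := (nhds_bot_basis (α := ℝ≥0)).eventually_iff.1 hsmall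
  have hδ0 : (0 : ℝ) < δ := by exact_mod_cast hδ
  refine ⟨σ + σ * |K| / δ, fun m hm t => ?_⟩
  have hm0 : 0 < m := lt_trans (by positivity) hm
  rcases lt_or_ge t δ with ht | ht
  · have hbt : σ * b t ≤ ε := by
      rw [← le_div_iff₀' hσ]
      exact (hδb ht).le
    have : 0 ≤ m * t := by positivity
    linarith
  · have hbt : σ * b t ≤ σ * (|K| + t) := by
      have : b t - 1 * t ≤ K := hK ⟨t, rfl⟩
      gcongr
      linarith [le_abs_self K]
    have hdrift : (σ + σ * |K| / δ) * t ≤ m * t := by gcongr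
    have hK' : σ * |K| ≤ σ * |K| / δ * t := by
      rw [div_mul_eq_mul_div, le_div_iff₀ hδ0]
      gcongr
    linarith

lemma eventually_forall_X_le (hμ : IsDriftFunction μ) (hb : IsDriftDominated fun t => B t ω)
    (hσ : 0 < σ) {ε : ℝ} (hε : 0 < ε) :
    ∀ᶠ a : ℝ≥0 in 𝓝 0, ∀ t, X σ μ B t a ω ≤ ε := by
  obtain ⟨m₀, hm₀⟩ := hb.exists_forall_mul_sub_le hσ hε
  have hlarge : ∀ᶠ x : ℝ in 𝓝[>] 0, m₀ < μ x := hμ.tendsto_zero.eventually_gt_atTop _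
  obtain ⟨η, hη, hlarge⟩ := mem_nhdsGT_iff_exists_Ioo_subset.1 hlarge
  filter_upwards [Iio_mem_nhds (show (0 : ℝ≥0) < η.toNNReal from Real.toNNReal_pos.2 hη)]
    with a ha t
  rcases eq_or_ne a 0 with rfl | ha0
  · simpa using hε.le
  · rw [X_of_ne_zero (by exact_mod_cast ha0), IsDriftFunction.driftExt_coe]
    exact hm₀ _ (hlarge ⟨by positivity, by simpa [Real.lt_toNNReal_iff_coe_lt] using ha⟩) t

lemma tendsto_Mstar_nhds_zero (hμ : IsDriftFunction μ) (hb : IsDriftDominated fun t => B t ω)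
    (hσ : 0 < σ) : Tendsto (fun a : ℝ≥0 => Mstar σ μ B a ω) (𝓝 0) (𝓝 0) := by
  rw [Metric.tendsto_nhds]
  intro ε hε
  filter_upwards [eventually_forall_X_le hμ hb hσ (half_pos hε)] with a ha
  rw [Real.dist_eq, sub_zero, abs_of_nonneg (Mstar_nonneg hb.zero _)]
  exact (Mstar_le ha).trans_lt (half_lt_self hε)

lemma continuous_Mstar (hμ : IsDriftFunction μ) (hb : IsDriftDominated fun t => B t ω)
    (hσ : 0 < σ) : Continuous fun a : ℝ≥0 => Mstar σ μ B a ω := by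
  refine continuous_iff_continuousAt.2 fun a => ?_
  rcases eq_or_ne a 0 with rfl | ha
  · rw [ContinuousAt, ENNReal.coe_zero, Mstar_apply_zero]
    exact tendsto_Mstar_nhds_zero hμ hb hσ
  · have hc : a + 1 ≠ 0 := by positivity
    obtain ⟨t, ht⟩ := (eventually_runMax_eq hμ hb hσ (c := ((a + 1 : ℝ≥0) : ℝ≥0∞))
      (by exact_mod_cast hc) (hμ.driftExt_coe_pos hc)).exists
    refine (continuousAt_runMax (σ := σ) hμ hb.continuous t ha).congr ?_
    filter_upwards [Iio_mem_nhds (show a < a + 1 by simp)] with c hc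
    exact ht c (by exact_mod_cast (mem_Iio.1 hc).le)

/-- The almost sure properties of the path of a finite initial condition, both expectations being
replaced by finiteness. -/
structure IsFiniteInitialPath (w : ℝ≥0 → Ω → ℝ≥0) (ω : Ω) : Prop where
  continuous : Continuous fun a => w a ω
  monotone : Monotone fun a => w a ω
  zero : w 0 ω = 0
  infty_lt_top : initAtInfty w ω < ∞
  lintegral_lt_top : (∫⁻ a in Ioc (0 : ℝ) 1, ENNReal.ofReal (w a.toNNReal ω / a ^ 2)) < ∞

lemma initAtInfty_eq_iSup (hw : Monotone fun a => w a ω) :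
    initAtInfty w ω = ⨆ a, (w a ω : ℝ≥0∞) := by
  have : Monotone fun a => (w a ω : ℝ≥0∞) := fun _ _ h => ENNReal.coe_le_coe.2 (hw h)
  exact (tendsto_atTop_iSup this).limUnder_eq

@[simp] lemma initExt_coe (a : ℝ≥0) : initExt w a ω = w a ω := by simp [initExt]

lemma initExt_zero : initExt w 0 ω = w 0 ω := initExt_coe 0

lemma initExt_nonneg (a : ℝ≥0∞) : 0 ≤ initExt w a ω := by
  unfold initExt
  split_ifs <;> positivity

namespace IsFiniteInitialPath

lemma coe_le_infty (hw : IsFiniteInitialPath w ω) (a : ℝ≥0) :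
    (w a ω : ℝ) ≤ (initAtInfty w ω).toReal := by
  have h : (w a ω : ℝ≥0∞) ≤ initAtInfty w ω := by
    rw [initAtInfty_eq_iSup hw.monotone]
    exact le_iSup (fun a => (w a ω : ℝ≥0∞)) a
  exact ENNReal.toReal_mono hw.infty_lt_top.ne h

lemma initExt_mono (hw : IsFiniteInitialPath w ω) : Monotone fun a => initExt w a ω := by
  intro a c hac
  rcases eq_or_ne c ∞ with rfl | hc
  · rcases eq_or_ne a ∞ with rfl | ha
    · exact le_rfl
    · simpa [initExt, ha] using hw.coe_le_infty a.toNNReal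
  · have ha : a ≠ ∞ := ne_top_of_le_ne_top hc hac
    simpa [initExt, ha, hc] using hw.monotone (ENNReal.toNNReal_mono hc hac)

lemma lintegral_Ioi_lt_top (hw : IsFiniteInitialPath w ω) :
    (∫⁻ x in Ioi (0 : ℝ), ENNReal.ofReal (w x.toNNReal ω / x ^ 2)) < ∞ := by
  rw [← Ioc_union_Ioi_eq_Ioi (zero_le_one (α := ℝ))]
  refine (lintegral_union_le _ _ _).trans_lt (ENNReal.add_lt_top.2 ⟨hw.lintegral_lt_top, ?_⟩)
  have hi : IntegrableOn (fun x : ℝ => (initAtInfty w ω).toReal * x ^ (-2 : ℝ)) (Ioi 1) :=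
    (integrableOn_Ioi_rpow_of_lt (by norm_num) one_pos).const_mul _
  refine lt_of_le_of_lt (setLIntegral_mono' measurableSet_Ioi fun x hx => ?_)
    hi.lintegral_lt_top
  have hx0 : (0 : ℝ) < x := one_pos.trans hx
  refine ENNReal.ofReal_le_ofReal ?_
  rw [Real.rpow_neg hx0.le, Real.rpow_two, ← div_eq_mul_inv]
  gcongr
  exact hw.coe_le_infty _

end IsFiniteInitialPath

/-- The process `max (sup_{s ≤ t} X_s(a), w(a) + X_t(a))`, which has the law of `W_t(a)` by time
reversal of the Brownian motion. -/
def Wrev (σ : ℝ) (μ : ℝ → ℝ) (B : ℝ≥0 → Ω → ℝ) (w : ℝ≥0 → Ω → ℝ≥0)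
    (t : ℝ≥0) (a : ℝ≥0∞) (ω : Ω) : ℝ :=
  max (runMax σ μ B t a ω) (chi σ μ B w t a ω)

lemma Wrev_nonneg (hb : Continuous fun t => B t ω) (h0 : B 0 ω = 0) (t : ℝ≥0) (a : ℝ≥0∞) :
    0 ≤ Wrev σ μ B w t a ω :=
  (runMax_nonneg hb h0 t a).trans (le_max_left _ _)

lemma Wrev_apply_zero (hw : IsFiniteInitialPath w ω) (t : ℝ≥0) : Wrev σ μ B w t 0 ω = 0 := by
  simp [Wrev, runMax_apply_zero, chi, initExt_zero, hw.zero]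

lemma Wrev_mono (hμ : IsDriftFunction μ) (hb : Continuous fun t => B t ω) (h0 : B 0 ω = 0)
    (hw : IsFiniteInitialPath w ω) (t : ℝ≥0) : Monotone fun a => Wrev σ μ B w t a ω := by
  intro a c hac
  rcases eq_or_ne a 0 with rfl | ha
  · simp only [Wrev_apply_zero hw]
    exact Wrev_nonneg hb h0 t c
  · exact max_le_max (runMax_mono hμ hb h0 t hac)
      (add_le_add (hw.initExt_mono hac) (X_mono hμ t ha hac))

lemma Wrev_le (hb : IsDriftDominated fun t => B t ω) (hσ : 0 < σ) {a : ℝ≥0∞}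
    (ha : a ≠ 0 → 0 < driftExt μ a) (t : ℝ≥0) :
    Wrev σ μ B w t a ω ≤ Mstar σ μ B a ω + initExt w a ω := by
  refine max_le ?_ ?_
  · linarith [runMax_le_Mstar hb hσ ha t, initExt_nonneg (w := w) (ω := ω) a]
  · rw [chi]
    linarith [le_Mstar hb hσ ha t]

lemma eventually_Wrev_eq (hμ : IsDriftFunction μ) (hb : IsDriftDominated fun t => B t ω)
    (hσ : 0 < σ) (hw : IsFiniteInitialPath w ω) {c : ℝ≥0∞} (hc : c ≠ 0) (hd : 0 < driftExt μ c) :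
    ∀ᶠ t in atTop, ∀ a ≤ c, Wrev σ μ B w t a ω = Mstar σ μ B a ω := by
  filter_upwards [eventually_runMax_eq hμ hb hσ hc hd,
    eventually_X_lt (μ := μ) hb hσ hc hd (-initExt w c ω)] with t h1 h2 a hac
  rcases eq_or_ne a 0 with rfl | ha
  · rw [Wrev_apply_zero hw, Mstar_apply_zero]
  rw [Wrev, h1 a hac, max_eq_left]
  refine le_trans ?_ (Mstar_nonneg hb.zero a)
  have h3 := hw.initExt_mono hac
  have h4 := X_mono (σ := σ) (B := B) (ω := ω) hμ t ha hac
  dsimp only at h3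
  rw [chi]
  linarith

lemma continuous_Wrev (hμ : IsDriftFunction μ) (hb : IsDriftDominated fun t => B t ω) (hσ : 0 < σ)
    (hw : IsFiniteInitialPath w ω) (t : ℝ≥0) : Continuous fun a : ℝ≥0 => Wrev σ μ B w t a ω := by
  have hwc : Continuous fun a : ℝ≥0 => initExt w a ω := by
    simp only [initExt_coe]
    exact NNReal.continuous_coe.comp hw.continuous
  refine continuous_iff_continuousAt.2 fun a => ?_
  rcases eq_or_ne a 0 with rfl | ha
  · rw [ContinuousAt, ENNReal.coe_zero, Wrev_apply_zero hw]
    have h : Tendsto (fun a : ℝ≥0 => Mstar σ μ B a ω + initExt w a ω) (𝓝 0) (𝓝 0) := by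
      have := ((continuous_Mstar (σ := σ) hμ hb hσ).tendsto 0).add (hwc.tendsto 0)
      simpa [initExt_zero, hw.zero] using this
    refine tendsto_of_tendsto_of_tendsto_of_le_of_le tendsto_const_nhds h
      (fun a => Wrev_nonneg hb.continuous hb.zero t a) fun a => ?_
    exact Wrev_le hb hσ (fun h => hμ.driftExt_coe_pos (by exact_mod_cast h)) t
  · refine (continuousAt_runMax hμ hb.continuous t ha).max (hwc.continuousAt.add ?_)
    have : ContinuousAt (fun c : ℝ≥0 => σ * B t ω - driftExt μ c * t) a :=
      continuousAt_const.sub ((continuousAt_driftExt hμ ha).mul continuousAt_const)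
    refine this.congr ?_
    filter_upwards [isOpen_ne.mem_nhds ha] with c hc
    rw [X_of_ne_zero (by exact_mod_cast hc)]

/-- Time reversal of a path on `[0, t]`, continued by the original path after time `t` so that the
reversal of a Brownian motion is a Brownian motion. -/
def revProc (t : ℝ≥0) (B : ℝ≥0 → Ω → ℝ) (s : ℝ≥0) (ω : Ω) : ℝ :=
  if s ≤ t then B t ω - B (t - s) ω else B s ω

lemma continuous_revProc (hb : Continuous fun t => B t ω) (h0 : B 0 ω = 0) (t : ℝ≥0) :
    Continuous fun s => revProc t B s ω := by
  refine Continuous.if_le ?_ hb continuous_id continuous_const ?_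
  · exact continuous_const.sub (hb.comp (continuous_const.sub continuous_id))
  · rintro s rfl
    simp [h0]

lemma IsDriftDominated.revProc (hb : IsDriftDominated fun t => B t ω) (t : ℝ≥0) :
    IsDriftDominated fun s => revProc t B s ω := by
  have hc := continuous_revProc hb.continuous hb.zero t
  refine ⟨hc, by simp [RCBM.revProc], fun m hm => ?_⟩
  obtain ⟨K, hK⟩ := hb.bddAbove m hm
  obtain ⟨K', hK'⟩ := (isCompact_Icc (a := (0 : ℝ≥0)) (b := t)).bddAbove_image
    (f := fun s : ℝ≥0 => RCBM.revProc t B s ω - m * s) (by fun_prop)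
  refine ⟨max K K', ?_⟩
  rintro _ ⟨s, rfl⟩
  by_cases hs : s ≤ t
  · exact (hK' ⟨s, ⟨zero_le, hs⟩, rfl⟩).trans (le_max_right _ _)
  · refine le_trans ?_ (le_max_left _ _)
    simp only [RCBM.revProc, hs, if_false]
    exact hK ⟨s, rfl⟩

lemma X_revProc {s t : ℝ≥0} (hst : s ≤ t) (a : ℝ≥0∞) :
    X σ μ (revProc t B) (t - s) a ω = X σ μ B t a ω - X σ μ B s a ω := by
  rcases eq_or_ne a 0 with rfl | ha
  · simp
  · simp only [X_of_ne_zero ha, revProc, tsub_le_self, if_true, tsub_tsub_cancel_of_le hst,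
      NNReal.coe_sub hst]
    ring

lemma runMax_revProc (hb : Continuous fun t => B t ω) (h0 : B 0 ω = 0) (t : ℝ≥0) (a : ℝ≥0∞) :
    runMax σ μ (revProc t B) t a ω =
      chi σ μ B w t a ω - sInf ((fun s => chi σ μ B w s a ω) '' Icc 0 t) := by
  have hincr (s : ℝ≥0) (hs : s ≤ t) : X σ μ (revProc t B) (t - s) a ω
      = chi σ μ B w t a ω - chi σ μ B w s a ω := by
    rw [X_revProc hs, chi, chi]; ring
  have hbdd : BddBelow ((fun s => chi σ μ B w s a ω) '' Icc 0 t) :=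
    (isCompact_Icc.image (continuous_const.add (continuous_X hb a))).bddBelow
  refine le_antisymm (runMax_le fun s hs => ?_) (sub_le_comm.1 (le_csInf ?_ ?_))
  · rw [← tsub_tsub_cancel_of_le hs, hincr _ tsub_le_self]
    exact sub_le_sub_left (csInf_le hbdd ⟨t - s, ⟨zero_le, tsub_le_self⟩, rfl⟩) _
  · exact ⟨_, 0, ⟨le_rfl, zero_le⟩, rfl⟩
  · rintro _ ⟨s, hs, rfl⟩
    rw [sub_le_comm, ← hincr s hs.2]
    exact le_runMax (continuous_revProc hb h0 t) tsub_le_self a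

lemma W_eq_Wrev_revProc (hb : Continuous fun t => B t ω) (h0 : B 0 ω = 0) (t : ℝ≥0)
    (a : ℝ≥0∞) : W σ μ B w t a ω = Wrev σ μ (revProc t B) w t a ω := by
  have hchi : chi σ μ (revProc t B) w t a ω = chi σ μ B w t a ω := by
    have := X_revProc (σ := σ) (μ := μ) (B := B) (ω := ω) (zero_le (a := t)) a
    rw [tsub_zero, X_zero_time h0, sub_zero] at this
    rw [chi, chi, this]
  rw [W, skorokhodMap, Wrev, runMax_revProc (w := w) hb h0, hchi]
  set m := sInf ((fun s => chi σ μ B w s a ω) '' Icc 0 t)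
  rcases le_total m 0 with h | h
  · rw [min_eq_left h, max_eq_left (by linarith)]
  · rw [min_eq_right h, max_eq_right (by linarith), sub_zero]

end Pathwise

section BrownianMaximum

variable {Ω : Type*} {B : ℝ≥0 → Ω → ℝ}

/-- The exponential martingale `exp (θ B_t - θ² t / 2)` of a Brownian motion `B`. -/
def expMartingale (B : ℝ≥0 → Ω → ℝ) (θ : ℝ) (t : ℝ≥0) (ω : Ω) : ℝ :=
  Real.exp (θ * B t ω - θ ^ 2 / 2 * t)

lemma expMartingale_eq (θ : ℝ) (t : ℝ≥0) :
    expMartingale B θ t = fun ω => Real.exp (-(θ ^ 2 / 2 * t)) * Real.exp (θ * B t ω) := by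
  funext ω
  rw [expMartingale, ← Real.exp_add]
  congr 1
  ring

lemma expMartingale_add (B : ℝ≥0 → Ω → ℝ) (θ : ℝ) (s t : ℝ≥0) :
    expMartingale B θ (s + t) =
      expMartingale B θ s * expMartingale (fun u ω => B (s + u) ω - B s ω) θ t := by
  funext ω
  simp only [expMartingale, Pi.mul_apply, ← Real.exp_add]
  congr 1
  push_cast
  ring

variable [MeasurableSpace Ω] {P : Measure Ω} {m : ℝ}

lemma integrable_expMartingale (hB : IsPreBrownianReal B P) (θ : ℝ) (t : ℝ≥0) :
    Integrable (expMartingale B θ t) P := by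
  rw [expMartingale_eq]
  refine Integrable.const_mul ?_ _
  have h := integrable_exp_mul_gaussianReal (μ := 0) (v := t) θ
  rw [← (hB.hasLaw_eval t).map_eq] at h
  exact h.comp_aemeasurable (hB.aemeasurable t)

lemma integral_expMartingale (hB : IsPreBrownianReal B P) (θ : ℝ) (t : ℝ≥0) :
    ∫ ω, expMartingale B θ t ω ∂P = 1 := by
  have h : mgf (B t) P θ = Real.exp (0 * θ + t * θ ^ 2 / 2) :=
    mgf_gaussianReal (hB.hasLaw_eval t).map_eq θ
  rw [expMartingale_eq, integral_const_mul]
  change _ * mgf (B t) P θ = 1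
  rw [h, ← Real.exp_add, Real.exp_eq_one_iff]
  ring

lemma indep_shift_natural (hB : IsPreBrownianReal B P) (hm : ∀ t, StronglyMeasurable (B t))
    (s t : ℝ≥0) :
    Indep (MeasurableSpace.comap (fun ω => B (s + t) ω - B s ω) inferInstance)
      (Filtration.natural B hm s) P := by
  refine indep_of_indep_of_le_right ((IndepFun_iff_Indep _ _ _).1 ((hB.indepFun_shift s).comp
    (φ := fun u : ℝ≥0 → ℝ => u t) (ψ := id) (measurable_pi_apply t) measurable_id)) ?_
  refine iSup₂_le fun r hr => ?_
  have hproj : Measurable fun u : Iic s → ℝ => u ⟨r, hr⟩ := measurable_pi_apply _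
  exact (hproj.comp (comap_measurable fun ω (r : Iic s) => B r ω)).comap_le

lemma martingale_expMartingale [IsProbabilityMeasure P] (hB : IsPreBrownianReal B P)
    (hm : ∀ t, StronglyMeasurable (B t)) (θ : ℝ) :
    Martingale (expMartingale B θ) (Filtration.natural B hm) P := by
  have hadp : StronglyAdapted (Filtration.natural B hm) (expMartingale B θ) := fun t =>
    (Real.measurable_exp.comp (((Filtration.stronglyAdapted_natural hm t).measurable.const_mul
      θ).sub_const _)).stronglyMeasurable
  refine ⟨hadp, fun s t hst => ?_⟩
  set C : ℝ≥0 → Ω → ℝ := fun u ω => B (s + u) ω - B s ω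
  have hC : IsPreBrownianReal C P := hB.shift s
  have hfac : expMartingale B θ t = expMartingale B θ s * expMartingale C θ (t - s) := by
    rw [← expMartingale_add, add_tsub_cancel_of_le hst]
  have hincr : P[expMartingale C θ (t - s) | Filtration.natural B hm s] =ᵐ[P] fun _ => 1 := by
    have hCm : Measurable (C (t - s)) := (hm _).measurable.sub (hm _).measurable
    rw [← integral_expMartingale hC θ (t - s)]
    exact condExp_indep_eq hCm.comap_le ((Filtration.natural B hm).le s)
      (Real.measurable_exp.comp (((comap_measurable (C (t - s))).const_mul
        θ).sub_const _)).stronglyMeasurable (indep_shift_natural hB hm s (t - s))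
  rw [hfac]
  filter_upwards [condExp_mul_of_stronglyMeasurable_left (μ := P) (hadp s)
    (hfac ▸ integrable_expMartingale hB θ t) (integrable_expMartingale hC θ (t - s)), hincr]
    with ω hpull hone
  rw [hpull, Pi.mul_apply, hone, mul_one]

lemma measure_exists_seq_le_of_stronglyMeasurable [IsProbabilityMeasure P]
    (hB : IsPreBrownianReal B P) (hm : ∀ t, StronglyMeasurable (B t)) (hm0 : 0 < m) (x : ℝ)
    {u : ℕ → ℝ≥0} (hu : Monotone u) (N : ℕ) :
    P {ω | ∃ k ≤ N, x ≤ B (u k) ω - m * u k} ≤ ENNReal.ofReal (Real.exp (-(2 * m * x))) := by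
  let ℱ : Filtration ℕ ‹MeasurableSpace Ω› :=
    ⟨fun k => Filtration.natural B hm (u k), fun _ _ h => (Filtration.natural B hm).mono (hu h),
      fun k => (Filtration.natural B hm).le (u k)⟩
  -- The choice `θ = 2 m` turns the martingale into `exp (2 m (B_t - m t))`.
  have hmart := martingale_expMartingale hB hm (2 * m)
  have hmart' : Martingale (fun k => expMartingale B (2 * m) (u k)) ℱ P :=
    ⟨fun k => hmart.1 (u k), fun i j hij => hmart.2 _ _ (hu hij)⟩
  have hdoob := maximal_ineq hmart'.submartingale (fun k ω => (Real.exp_pos _).le)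
    (ε := (Real.exp (2 * m * x)).toNNReal) N
  set A := {ω | (((Real.exp (2 * m * x)).toNNReal : ℝ≥0) : ℝ) ≤
    (Finset.range (N + 1)).sup' Finset.nonempty_range_add_one
      fun k => expMartingale B (2 * m) (u k) ω} with hA
  have hsub : {ω | ∃ k ≤ N, x ≤ B (u k) ω - m * u k} ⊆ A := by
    rintro ω ⟨k, hk, hx⟩
    rw [hA, mem_ofPred_eq, Real.coe_toNNReal _ (Real.exp_pos _).le, Finset.le_sup'_iff]
    refine ⟨k, Finset.mem_range.2 (Nat.lt_succ_of_le hk), Real.exp_le_exp.2 ?_⟩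
    nlinarith
  have hint : ENNReal.ofReal (∫ ω in A, expMartingale B (2 * m) (u N) ω ∂P) ≤ 1 := by
    rw [← ENNReal.ofReal_one, ← integral_expMartingale hB (2 * m) (u N)]
    exact ENNReal.ofReal_le_ofReal (setIntegral_le_integral (integrable_expMartingale hB _ _)
      (.of_forall fun ω => (Real.exp_pos _).le))
  have hA1 : P A * ENNReal.ofReal (Real.exp (2 * m * x)) ≤ 1 :=
    (mul_comm _ _).trans_le (hdoob.trans hint)
  rw [Real.exp_neg, ENNReal.ofReal_inv_of_pos (Real.exp_pos _), ← one_div]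
  exact (measure_mono hsub).trans (ENNReal.le_div_iff_mul_le
    (.inl (ENNReal.ofReal_pos.2 (Real.exp_pos _)).ne') (.inl ENNReal.ofReal_ne_top) |>.2 hA1)

lemma measure_exists_seq_le [IsProbabilityMeasure P] (hB : IsPreBrownianReal B P) (hm0 : 0 < m)
    (x : ℝ) {u : ℕ → ℝ≥0} (hu : Monotone u) (N : ℕ) :
    P {ω | ∃ k ≤ N, x ≤ B (u k) ω - m * u k} ≤ ENNReal.ofReal (Real.exp (-(2 * m * x))) := by
  have hC : IsPreBrownianReal (fun t => (hB.aemeasurable t).mk (B t)) P :=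
    hB.congr fun t => (hB.aemeasurable t).ae_eq_mk
  refine le_trans (measure_mono_ae ?_) (measure_exists_seq_le_of_stronglyMeasurable hC
    (fun t => (hB.aemeasurable t).measurable_mk.stronglyMeasurable) hm0 x hu N)
  filter_upwards [ae_all_iff.2 fun k => (hB.aemeasurable (u k)).ae_eq_mk] with ω hω
  rintro ⟨k, hk, hx⟩
  exact ⟨k, hk, by rwa [← hω k]⟩

lemma tendsto_floor_mul_two_pow (t : ℝ≥0) :
    Tendsto (fun n : ℕ => (⌊(t : ℝ) * 2 ^ n⌋₊ : ℝ≥0) * 2⁻¹ ^ n) atTop (𝓝 t) := by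
  rw [← NNReal.tendsto_coe]
  have h : Tendsto (fun n : ℕ => (2 : ℝ) ^ n) atTop atTop :=
    tendsto_pow_atTop_atTop_of_one_lt one_lt_two
  refine ((tendsto_nat_floor_mul_div_atTop t.coe_nonneg).comp h).congr fun n => ?_
  simp [Function.comp, div_eq_mul_inv]

lemma exists_dyadic_lt {f : ℝ≥0 → ℝ} (hf : Continuous f) {x : ℝ} {t : ℝ≥0} (ht : x < f t) :
    ∃ n : ℕ, ∃ k ≤ n * 2 ^ n, x < f (k * 2⁻¹ ^ n) := by
  have hev := ((hf.tendsto t).comp (tendsto_floor_mul_two_pow t)).eventually_const_lt ht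
  obtain ⟨n, hn, htn⟩ := (hev.and (eventually_ge_atTop ⌈(t : ℝ)⌉₊)).exists
  refine ⟨n, ⌊(t : ℝ) * 2 ^ n⌋₊, Nat.floor_le_of_le ?_, hn⟩
  push_cast
  gcongr
  exact (Nat.le_ceil (t : ℝ)).trans (by exact_mod_cast htn)

lemma measure_exists_lt_le [IsProbabilityMeasure P] (hB : IsBrownianReal B P) (hm0 : 0 < m)
    (x : ℝ) :
    P {ω | ∃ t : ℝ≥0, x < B t ω - m * t} ≤ ENNReal.ofReal (Real.exp (-(2 * m * x))) := by
  set A : ℕ → Set Ω := fun n => {ω | ∃ k ≤ n * 2 ^ n,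
    x ≤ B (k * (2⁻¹ ^ n : ℝ≥0)) ω - m * (k * (2⁻¹ ^ n : ℝ≥0) : ℝ≥0)}
  have hmono : Monotone A := by
    refine monotone_nat_of_le_succ fun n ω ⟨k, hk, hx⟩ => ⟨2 * k, ?_, ?_⟩
    · calc 2 * k ≤ 2 * (n * 2 ^ n) := by gcongr
        _ = n * 2 ^ (n + 1) := by ring
        _ ≤ (n + 1) * 2 ^ (n + 1) := by gcongr; omega
    · have : ((2 * k : ℕ) : ℝ≥0) * 2⁻¹ ^ (n + 1) = k * 2⁻¹ ^ n := by
        push_cast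
        rw [pow_succ]
        field_simp
      rwa [this]
  calc P {ω | ∃ t : ℝ≥0, x < B t ω - m * t} ≤ P (⋃ n, A n) := by
        refine measure_mono_ae ?_
        filter_upwards [hB.cont] with ω hω
        rintro ⟨t, ht⟩
        obtain ⟨n, k, hk, hx⟩ :=
          exists_dyadic_lt (f := fun t : ℝ≥0 => B t ω - m * t) (by fun_prop) ht
        exact mem_iUnion.2 ⟨n, k, hk, hx.le⟩
    _ = ⨆ n, P (A n) := hmono.measure_iUnion
    _ ≤ _ := iSup_le fun n => measure_exists_seq_le hB.toIsPreBrownianReal hm0 x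
      (Nat.mono_cast.mul_const zero_le) _

lemma ae_bddAbove_sub_mul [IsProbabilityMeasure P] (hB : IsBrownianReal B P) (hm0 : 0 < m) :
    ∀ᵐ ω ∂P, BddAbove (range fun t : ℝ≥0 => B t ω - m * t) := by
  rw [ae_iff]
  refine le_antisymm ?_ zero_le
  have hlim : Tendsto (fun x : ℝ => ENNReal.ofReal (Real.exp (-(2 * m * x)))) atTop (𝓝 0) := by
    rw [← ENNReal.ofReal_zero]
    refine (ENNReal.continuous_ofReal.tendsto 0).comp (Real.tendsto_exp_neg_atTop_nhds_zero.comp ?_)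
    exact tendsto_id.const_mul_atTop (by positivity)
  refine ge_of_tendsto' hlim fun x => le_trans (measure_mono fun ω hω => ?_)
    (measure_exists_lt_le hB hm0 x)
  simpa using not_bddAbove_iff.1 hω x

lemma ae_isDriftDominated [IsProbabilityMeasure P] (hB : IsBrownianReal B P) :
    ∀ᵐ ω ∂P, IsDriftDominated fun t => B t ω := by
  filter_upwards [hB.cont, hB.eval_zero_ae_eq_zero,
    ae_all_iff.2 fun n : ℕ => ae_bddAbove_sub_mul hB (Nat.one_div_pos_of_nat (α := ℝ) (n := n))]
    with ω hcont hzero hbdd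
  refine ⟨hcont, hzero, fun m hm => ?_⟩
  obtain ⟨n, hn⟩ := exists_nat_one_div_lt hm
  refine (hbdd n).range_mono _ fun t => ?_
  gcongr

lemma lintegral_exp_neg_mul {c : ℝ} (hc : 0 < c) :
    ∫⁻ x in Ioi (0 : ℝ), ENNReal.ofReal (Real.exp (-(c * x))) = ENNReal.ofReal (1 / c) := by
  have hi : IntegrableOn (fun x : ℝ => Real.exp (-(c * x))) (Ioi 0) := by
    simpa using exp_neg_integrableOn_Ioi 0 hc
  rw [← ofReal_integral_eq_lintegral_ofReal hi (.of_forall fun x => (Real.exp_pos _).le)]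
  congr 1
  simpa using integral_exp_mul_Ioi (neg_lt_zero.2 hc) 0

end BrownianMaximum

section CountableSampling

variable {Ω : Type*} {σ : ℝ} {μ : ℝ → ℝ} {B : ℝ≥0 → Ω → ℝ} {w : ℝ≥0 → Ω → ℝ≥0} {ω : Ω}

lemma ciSup_denseSeq {α : Type*} [TopologicalSpace α] [TopologicalSpace.SeparableSpace α]
    [Nonempty α] {u : α → ℝ} (hu : Continuous u) (hb : BddAbove (range u)) :
    ⨆ t, u t = ⨆ n, u (TopologicalSpace.denseSeq α n) := by
  have hb' : BddAbove (range fun n => u (TopologicalSpace.denseSeq α n)) :=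
    hb.mono (range_comp_subset_range _ u)
  refine le_antisymm (ciSup_le fun t => ?_) (ciSup_le fun n => le_ciSup hb _)
  exact isClosed_property (TopologicalSpace.denseRange_denseSeq α)
    (isClosed_le hu continuous_const) (fun n => le_ciSup hb' n) t

lemma runMax_eq_iSup (hb : Continuous fun t => B t ω) (t : ℝ≥0) (a : ℝ≥0∞) :
    runMax σ μ B t a ω = ⨆ n, X σ μ B (min (TopologicalSpace.denseSeq ℝ≥0 n) t) a ω := by
  have hrange : (fun s => X σ μ B s a ω) '' Icc 0 t = range fun s => X σ μ B (min s t) a ω := by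
    ext y
    constructor
    · rintro ⟨s, hs, rfl⟩
      exact ⟨s, by simp [min_eq_left hs.2]⟩
    · rintro ⟨s, rfl⟩
      exact ⟨min s t, ⟨zero_le, min_le_right _ _⟩, rfl⟩
  rw [runMax, hrange]
  refine ciSup_denseSeq (u := fun s => X σ μ B (min s t) a ω)
    ((continuous_X hb a).comp (continuous_id.min continuous_const)) ?_
  rw [← hrange]
  exact (isCompact_Icc.image (continuous_X hb a)).bddAbove

/-- A countable dense set of times in `[0, t]`, with the index `none` reserved for `t` itself. -/
def gridTime (t : ℝ≥0) : Option ℕ → ℝ≥0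
  | none => t
  | some n => min (TopologicalSpace.denseSeq ℝ≥0 n) t

/-- `Wrev` at `t` and `a` as a measurable function of the initial value `x = w(a)` and of the
values `v` of the driving path at the times `gridTime t`. -/
def backwardFun (σ : ℝ) (μ : ℝ → ℝ) (t : ℝ≥0) (a : ℝ≥0∞) (x : ℝ) (v : Option ℕ → ℝ) : ℝ :=
  max (⨆ n : ℕ, if a = 0 then 0 else σ * v (some n) - driftExt μ a * gridTime t (some n))
    (x + if a = 0 then 0 else σ * v none - driftExt μ a * t)

lemma measurable_backwardFun (t : ℝ≥0) (a : ℝ≥0∞) :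
    Measurable fun p : ℝ × (Option ℕ → ℝ) => backwardFun σ μ t a p.1 p.2 := by
  unfold backwardFun
  refine (Measurable.iSup fun n => ?_).max (measurable_fst.add ?_)
  · split_ifs <;> fun_prop
  · split_ifs <;> fun_prop

lemma Wrev_eq_backwardFun (hb : Continuous fun t => B t ω) (t : ℝ≥0) (a : ℝ≥0∞) :
    Wrev σ μ B w t a ω = backwardFun σ μ t a (initExt w a ω) fun i => B (gridTime t i) ω := by
  rw [Wrev, runMax_eq_iSup hb]
  rfl

/-- The values of `Wrev` at time `t` on the countable set sampled by `denseValues`, as a measurable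
function of the values of the initial condition there and of the driving path at `gridTime t`. -/
def backwardValues (σ : ℝ) (μ : ℝ → ℝ) (t : ℝ≥0) (p : ((ℕ → ℝ) × ℝ) × (Option ℕ → ℝ)) :
    (ℕ → ℝ) × ℝ :=
  (fun n => backwardFun σ μ t (TopologicalSpace.denseSeq ℝ≥0 n) (p.1.1 n) p.2,
    backwardFun σ μ t ∞ p.1.2 p.2)

lemma measurable_backwardValues (t : ℝ≥0) : Measurable (backwardValues σ μ t) := by
  refine (measurable_pi_iff.2 fun n => ?_).prodMk ?_
  · exact (measurable_backwardFun t _).comp (by fun_prop : Measurable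
      fun p : ((ℕ → ℝ) × ℝ) × (Option ℕ → ℝ) => (p.1.1 n, p.2))
  · exact (measurable_backwardFun t _).comp (by fun_prop : Measurable
      fun p : ((ℕ → ℝ) × ℝ) × (Option ℕ → ℝ) => (p.1.2, p.2))

lemma denseValues_Wrev (hb : Continuous fun t => B t ω) (t : ℝ≥0) :
    denseValues (fun a => Wrev σ μ B w t a ω) = backwardValues σ μ t
      (denseValues fun a => initExt w a ω, fun i => B (gridTime t i) ω) := by
  simp only [denseValues, backwardValues, Wrev_eq_backwardFun hb]

lemma initAtInfty_eq_iSup_nat (hw : Monotone fun a => w a ω) :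
    initAtInfty w ω = ⨆ n : ℕ, (w n ω : ℝ≥0∞) := by
  rw [initAtInfty_eq_iSup hw]
  refine le_antisymm (iSup_le fun a => ?_) (iSup_le fun n => le_iSup (fun a => (w a ω : ℝ≥0∞)) n)
  exact (ENNReal.coe_le_coe.2 (hw (Nat.le_ceil a))).trans
    (le_iSup (fun n : ℕ => (w n ω : ℝ≥0∞)) ⌈a⌉₊)

variable [MeasurableSpace Ω] {P : Measure Ω}

lemma aemeasurable_initAtInfty (hwm : ∀ a, AEMeasurable (w a) P)
    (hmono : ∀ᵐ ω ∂P, Monotone fun a => w a ω) : AEMeasurable (initAtInfty w) P :=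
  (AEMeasurable.iSup fun n : ℕ => (hwm n).coe_nnreal_ennreal).congr
    (hmono.mono fun _ hω => (initAtInfty_eq_iSup_nat hω).symm)

lemma aemeasurable_denseValues_initExt (hwm : ∀ a, AEMeasurable (w a) P)
    (hmono : ∀ᵐ ω ∂P, Monotone fun a => w a ω) :
    AEMeasurable (fun ω => denseValues fun a => initExt w a ω) P := by
  simp only [denseValues, initExt_coe]
  refine AEMeasurable.prodMk (aemeasurable_pi_lambda _ fun n => (hwm _).coe_nnreal_real) ?_
  exact (aemeasurable_initAtInfty hwm hmono).ennreal_toReal.congr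
    (.of_forall fun ω => by simp only [initExt, if_true])

lemma indepFun_denseValues_initExt {γ : Type*} [MeasurableSpace γ] {Y : Ω → γ}
    (hi : IndepFun (fun ω a => w a ω) Y P) (hmono : ∀ᵐ ω ∂P, Monotone fun a => w a ω) :
    IndepFun (fun ω => denseValues fun a => initExt w a ω) Y P := by
  let φ (v : ℝ≥0 → ℝ≥0) : (ℕ → ℝ) × ℝ :=
    (fun n => v (TopologicalSpace.denseSeq ℝ≥0 n), (⨆ n : ℕ, (v n : ℝ≥0∞)).toReal)
  have hφ : Measurable φ :=
    Measurable.prodMk (by fun_prop) (Measurable.iSup fun n => by fun_prop).ennreal_toReal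
  refine (hi.comp hφ measurable_id).congr ?_ .rfl
  filter_upwards [hmono] with ω hω
  simp only [φ, Function.comp, denseValues, initExt_coe]
  rw [initExt, if_pos rfl, initAtInfty_eq_iSup_nat hω]

end CountableSampling

section ExpectedMaximum

variable {Ω : Type*} [MeasurableSpace Ω] {P : Measure Ω} {σ : ℝ} {μ : ℝ → ℝ} {B : ℝ≥0 → Ω → ℝ}

lemma aemeasurable_X {t : ℝ≥0} (hB : AEMeasurable (B t) P) (a : ℝ≥0∞) :
    AEMeasurable (fun ω => X σ μ B t a ω) P := by
  unfold X
  split_ifs <;> fun_prop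

lemma aemeasurable_Mstar [IsProbabilityMeasure P] (hB : IsBrownianReal B P) (hσ : 0 < σ)
    {a : ℝ≥0∞} (ha : a ≠ 0 → 0 < driftExt μ a) :
    AEMeasurable (fun ω => Mstar σ μ B a ω) P := by
  refine (AEMeasurable.iSup fun n => aemeasurable_X (σ := σ) (μ := μ)
    (hB.aemeasurable (TopologicalSpace.denseSeq ℝ≥0 n)) a).congr ?_
  filter_upwards [ae_isDriftDominated hB] with ω hω
  exact (ciSup_denseSeq (continuous_X hω.continuous a) (bddAbove_X hω hσ ha)).symm

lemma measure_lt_Mstar_le [IsProbabilityMeasure P] (hB : IsBrownianReal B P) (hσ : 0 < σ)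
    {a : ℝ≥0∞} (ha : a ≠ 0) (hd : 0 < driftExt μ a) (x : ℝ) :
    P {ω | x < Mstar σ μ B a ω} ≤ ENNReal.ofReal (Real.exp (-(2 * driftExt μ a / σ ^ 2 * x))) := by
  have hexp : 2 * (driftExt μ a / σ) * (x / σ) = 2 * driftExt μ a / σ ^ 2 * x := by field_simp
  rw [← hexp]
  refine le_trans (measure_mono fun ω hω => ?_) (measure_exists_lt_le hB (div_pos hd hσ) (x / σ))
  obtain ⟨t, ht⟩ := exists_lt_of_lt_ciSup (show x < ⨆ t, X σ μ B t a ω from hω)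
  rw [X_of_ne_zero ha] at ht
  have hscale : (B t ω - driftExt μ a / σ * t) * σ = σ * B t ω - driftExt μ a * t := by field_simp
  exact ⟨t, (div_lt_iff₀ hσ).2 (hscale ▸ ht)⟩

lemma lintegral_Mstar_le [IsProbabilityMeasure P] (hB : IsBrownianReal B P) (hσ : 0 < σ)
    {a : ℝ≥0∞} (ha : a ≠ 0) (hd : 0 < driftExt μ a) :
    ∫⁻ ω, ENNReal.ofReal (Mstar σ μ B a ω) ∂P ≤ ENNReal.ofReal (σ ^ 2 / (2 * driftExt μ a)) := by
  have hnonneg : 0 ≤ᵐ[P] fun ω => Mstar σ μ B a ω :=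
    hB.eval_zero_ae_eq_zero.mono fun ω hω => Mstar_nonneg hω a
  rw [lintegral_eq_lintegral_meas_lt P hnonneg (aemeasurable_Mstar hB hσ fun _ => hd)]
  calc ∫⁻ x in Ioi (0 : ℝ), P {ω | x < Mstar σ μ B a ω}
      ≤ ∫⁻ x in Ioi (0 : ℝ), ENNReal.ofReal (Real.exp (-(2 * driftExt μ a / σ ^ 2 * x))) :=
        lintegral_mono fun x => measure_lt_Mstar_le hB hσ ha hd x
    _ = ENNReal.ofReal (1 / (2 * driftExt μ a / σ ^ 2)) := lintegral_exp_neg_mul (by positivity)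
    _ = ENNReal.ofReal (σ ^ 2 / (2 * driftExt μ a)) := by rw [one_div_div]

end ExpectedMaximum

section TimeReversal

variable {Ω : Type*} {B C : ℝ≥0 → Ω → ℝ}

lemma revProc_of_le {s t : ℝ≥0} (hs : s ≤ t) : revProc t B s = B t - B (t - s) := by
  funext ω
  simp [revProc, hs]

lemma revProc_of_lt {s t : ℝ≥0} (hs : t < s) : revProc t B s = B s := by
  funext ω
  simp [revProc, hs]

variable [MeasurableSpace Ω] {P : Measure Ω}

lemma isGaussianProcess_revProc (hB : IsGaussianProcess B P) (t : ℝ≥0) :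
    IsGaussianProcess (revProc t B) P := by
  refine hB.of_isGaussianProcess fun s => ?_
  by_cases hs : s ≤ t
  · exact ⟨{t, t - s},
      { toFun x := x ⟨t, by simp⟩ - x ⟨t - s, by simp⟩
        map_add' x y := by simp; abel
        map_smul' c x := by simp; ring }, by simp [revProc, hs]⟩
  · exact ⟨{s},
      { toFun x := x ⟨s, by simp⟩
        map_add' x y := by simp
        map_smul' c x := by simp }, by simp [revProc, hs]⟩

lemma integral_revProc (hB : IsPreBrownianReal B P) (t s : ℝ≥0) :
    ∫ ω, revProc t B s ω ∂P = 0 := by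
  rcases le_or_gt s t with hs | hs
  · simp only [revProc_of_le hs, Pi.sub_apply]
    rw [integral_sub (hB.integrable_eval _) (hB.integrable_eval _), hB.integral_eval,
      hB.integral_eval, sub_zero]
  · rw [revProc_of_lt hs, hB.integral_eval]

lemma covariance_revProc (hB : IsPreBrownianReal B P) (t : ℝ≥0) {s u : ℝ≥0} (hsu : s ≤ u) :
    cov[revProc t B s, revProc t B u; P] = s := by
  have hP := hB.isGaussianProcess.isProbabilityMeasure
  have hL (s : ℝ≥0) : MemLp (B s) 2 P := (hB.isGaussianProcess.hasGaussianLaw_eval s).memLp_two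
  rcases le_or_gt u t with hu | hu
  · have hs := hsu.trans hu
    rw [revProc_of_le hs, revProc_of_le hu,
      covariance_sub_left (hL _) (hL _) ((hL _).sub (hL _)),
      covariance_sub_right (hL _) (hL _) (hL _), covariance_sub_right (hL _) (hL _) (hL _)]
    simp only [hB.covariance_eval]
    rw [min_self, min_eq_right (tsub_le_self : t - u ≤ t),
      min_eq_left (tsub_le_self : t - s ≤ t), min_eq_right (tsub_le_tsub_left hsu t),
      NNReal.coe_sub hs]
    ring
  rw [revProc_of_lt hu]
  rcases le_or_gt s t with hs | hs
  · rw [revProc_of_le hs, covariance_sub_left (hL _) (hL _) (hL _)]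
    simp only [hB.covariance_eval]
    rw [min_eq_left hu.le, min_eq_left (tsub_le_self.trans hu.le), NNReal.coe_sub hs]
    ring
  · rw [revProc_of_lt hs, hB.covariance_eval, min_eq_left hsu]

lemma isPreBrownianReal_revProc (hB : IsPreBrownianReal B P) (t : ℝ≥0) :
    IsPreBrownianReal (revProc t B) P :=
  (isGaussianProcess_revProc hB.isGaussianProcess t).isPreBrownianReal_of_covariance
    (integral_revProc hB t) fun _ _ => covariance_revProc hB t

lemma isBrownianReal_revProc [IsProbabilityMeasure P] (hB : IsBrownianReal B P) (t : ℝ≥0) :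
    IsBrownianReal (revProc t B) P where
  toIsPreBrownianReal := isPreBrownianReal_revProc hB.toIsPreBrownianReal t
  cont := (ae_isDriftDominated hB).mono fun _ hω => (hω.revProc t).continuous

lemma identDistrib_comp_of_isPreBrownianReal {ι : Type*} [Countable ι]
    (hB : IsPreBrownianReal B P) (hC : IsPreBrownianReal C P) (τ : ι → ℝ≥0) :
    IdentDistrib (fun ω i => B (τ i) ω) (fun ω i => C (τ i) ω) P P := by
  classical
  have hP := hB.isGaussianProcess.isProbabilityMeasure
  refine (identDistrib_iff_forall_finset_identDistrib
    (X := fun i ω => B (τ i) ω) (Y := fun i ω => C (τ i) ω)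
    (aemeasurable_pi_lambda _ fun i => hB.aemeasurable _)
    (aemeasurable_pi_lambda _ fun i => hC.aemeasurable _)).2 fun J => ?_
  have h : IdentDistrib (fun ω => (J.image τ).restrict (B · ω))
      (fun ω => (J.image τ).restrict (C · ω)) P P :=
    (hB.hasLaw _).identDistrib (hC.hasLaw _)
  exact h.comp (u := fun x (j : J) => x ⟨τ j, Finset.mem_image_of_mem τ j.2⟩) (by fun_prop)

variable [IsProbabilityMeasure P] {σ : ℝ} {μ : ℝ → ℝ} {w : ℝ≥0 → Ω → ℝ≥0}

lemma identDistrib_prodMk_revProc {γ ι : Type*} [MeasurableSpace γ] [Countable ι] {V : Ω → γ}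
    (hB : IsPreBrownianReal B P) (hV : AEMeasurable V P)
    (hi : IndepFun V (fun ω t => B t ω) P) (t : ℝ≥0) (τ : ι → ℝ≥0) :
    IdentDistrib (fun ω => (V ω, fun i => revProc t B (τ i) ω))
      (fun ω => (V ω, fun i => B (τ i) ω)) P P := by
  have hrev : Measurable fun (b : ℝ≥0 → ℝ) i => revProc t (fun s b' => b' s) (τ i) b := by
    refine measurable_pi_iff.2 fun i => ?_
    unfold revProc
    split_ifs <;> fun_prop
  have heval : Measurable fun (b : ℝ≥0 → ℝ) i => b (τ i) := by fun_prop
  exact (IdentDistrib.refl hV).prodMk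
    (identDistrib_comp_of_isPreBrownianReal (isPreBrownianReal_revProc hB t) hB τ)
    (hi.comp measurable_id hrev) (hi.comp measurable_id heval)

lemma identDistrib_W_Wrev (hB : IsBrownianReal B P) (hwm : ∀ a, AEMeasurable (w a) P)
    (hmono : ∀ᵐ ω ∂P, Monotone fun a => w a ω)
    (hi : IndepFun (fun ω a => w a ω) (fun ω t => B t ω) P) (t : ℝ≥0) :
    IdentDistrib (fun ω => denseValues fun a => W σ μ B w t a ω)
      (fun ω => denseValues fun a => Wrev σ μ B w t a ω) P P := by
  have hlaw := (identDistrib_prodMk_revProc hB.toIsPreBrownianReal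
    (aemeasurable_denseValues_initExt hwm hmono) (indepFun_denseValues_initExt hi hmono) t
    (gridTime t)).comp (measurable_backwardValues (σ := σ) (μ := μ) t)
  refine identDistrib_congr hlaw ?_ (hB.cont.mono fun ω hω => (denseValues_Wrev hω t).symm)
  filter_upwards [ae_isDriftDominated hB] with ω hω
  simp only [W_eq_Wrev_revProc hω.continuous hω.zero]
  exact (denseValues_Wrev (hω.revProc t).continuous t).symm

end TimeReversal

section BackwardConvergence

variable {Ω : Type*} {σ : ℝ} {μ : ℝ → ℝ} {B : ℝ≥0 → Ω → ℝ} {w : ℝ≥0 → Ω → ℝ≥0} {ω : Ω}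

lemma isAdmissible_Mstar (hμ : IsDriftFunction μ) (hb : IsDriftDominated fun t => B t ω)
    (hσ : 0 < σ)
    (hM : (∫⁻ x in Ioi (0 : ℝ), ENNReal.ofReal (Mstar σ μ B (ENNReal.ofReal x) ω / x ^ 2)) < ∞) :
    IsAdmissible fun a => Mstar σ μ B a ω where
  continuous := continuous_Mstar hμ hb hσ
  monotone a c hac := by
    rcases eq_or_ne a 0 with rfl | ha
    · simpa using Mstar_nonneg hb.zero _
    · have hc : c ≠ 0 := ((pos_iff_ne_zero.2 ha).trans_le hac).ne'
      exact Mstar_le fun t => (X_mono hμ t (by exact_mod_cast ha) (by exact_mod_cast hac)).trans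
        (le_Mstar hb hσ (fun _ => hμ.driftExt_coe_pos hc) t)
  zero := Mstar_apply_zero
  lintegral_lt_top := hM

/-- A bound, uniform in `t`, for the densities `Wrev_t(x) / x²`. -/
def densityBound (σ : ℝ) (μ : ℝ → ℝ) (B : ℝ≥0 → Ω → ℝ) (w : ℝ≥0 → Ω → ℝ≥0) (ω : Ω)
    (x : ℝ) : ℝ≥0∞ :=
  ENNReal.ofReal (Mstar σ μ B (ENNReal.ofReal x) ω / x ^ 2)
    + ENNReal.ofReal (w x.toNNReal ω / x ^ 2)

lemma lintegral_densityBound_lt_top (hM : IsAdmissible fun a => Mstar σ μ B a ω)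
    (hw : IsFiniteInitialPath w ω) : (∫⁻ x in Ioi (0 : ℝ), densityBound σ μ B w ω x) < ∞ := by
  have hmeas : Measurable fun x =>
      ENNReal.ofReal (Mstar σ μ B (ENNReal.ofReal x) ω / x ^ 2) :=
    (hM.continuous_ofReal.measurable.div (by fun_prop)).ennreal_ofReal
  unfold densityBound
  rw [lintegral_add_left hmeas]
  exact ENNReal.add_lt_top.2 ⟨hM.lintegral_lt_top, hw.lintegral_Ioi_lt_top⟩

lemma ofReal_Wrev_le_densityBound (hμ : IsDriftFunction μ)
    (hb : IsDriftDominated fun t => B t ω) (hσ : 0 < σ) (t : ℝ≥0) (x : ℝ) :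
    ENNReal.ofReal (Wrev σ μ B w t (ENNReal.ofReal x) ω / x ^ 2) ≤ densityBound σ μ B w ω x := by
  have hnonneg : 0 ≤ Mstar σ μ B (ENNReal.ofReal x) ω := Mstar_nonneg hb.zero _
  rw [densityBound, ← ENNReal.ofReal_add (by positivity) (by positivity), ← add_div,
    ← initExt_coe]
  gcongr
  exact Wrev_le hb hσ
    (fun h => hμ.driftExt_coe_pos (a := x.toNNReal) (ENNReal.coe_ne_zero.1 h)) t

lemma isAdmissible_Wrev (hμ : IsDriftFunction μ) (hb : IsDriftDominated fun t => B t ω)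
    (hσ : 0 < σ) (hw : IsFiniteInitialPath w ω) (hM : IsAdmissible fun a => Mstar σ μ B a ω)
    (t : ℝ≥0) : IsAdmissible fun a => Wrev σ μ B w t a ω where
  continuous := continuous_Wrev hμ hb hσ hw t
  monotone _ _ hac := Wrev_mono hμ hb.continuous hb.zero hw t (ENNReal.coe_le_coe.2 hac)
  zero := Wrev_apply_zero hw t
  lintegral_lt_top := (lintegral_mono fun x => ofReal_Wrev_le_densityBound hμ hb hσ t x).trans_lt
    (lintegral_densityBound_lt_top hM hw)

lemma tendsto_toPath {ι : Type*} {l : Filter ι} {F : ι → ℝ≥0∞ → ℝ} {f : ℝ≥0∞ → ℝ}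
    (hF : ∀ i, Continuous fun a : ℝ≥0 => F i a) (hf : Continuous fun a : ℝ≥0 => f a)
    (hloc : ∀ c : ℝ≥0, ∀ᶠ i in l, ∀ a : ℝ≥0, a ≤ c → F i a = f a) :
    Tendsto (fun i => toPath (F i)) l (𝓝 (toPath f)) := by
  rw [ContinuousMap.tendsto_iff_forall_isCompact_tendstoUniformlyOn]
  intro K hK
  obtain ⟨c, hc⟩ := hK.bddAbove
  rw [Metric.tendstoUniformlyOn_iff]
  intro ε hε
  filter_upwards [hloc c] with i hi a ha
  rwa [toPath_apply (hF i), toPath_apply hf, hi a (hc ha), dist_self]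

lemma eventually_Wrev_coe_eq (hμ : IsDriftFunction μ) (hb : IsDriftDominated fun t => B t ω)
    (hσ : 0 < σ) (hw : IsFiniteInitialPath w ω) (c : ℝ≥0) :
    ∀ᶠ t in atTop, ∀ a : ℝ≥0, a ≤ c → Wrev σ μ B w t a ω = Mstar σ μ B a ω := by
  have hc : c + 1 ≠ 0 := by positivity
  filter_upwards [eventually_Wrev_eq hμ hb hσ hw (c := ((c + 1 : ℝ≥0) : ℝ≥0∞))
    (by exact_mod_cast hc) (hμ.driftExt_coe_pos hc)] with t ht a ha
  exact ht a (by exact_mod_cast ha.trans (le_add_of_nonneg_right zero_le_one))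

lemma tendsto_toPath_Wrev (hμ : IsDriftFunction μ) (hb : IsDriftDominated fun t => B t ω)
    (hσ : 0 < σ) (hw : IsFiniteInitialPath w ω) :
    Tendsto (fun t => toPath fun a => Wrev σ μ B w t a ω) atTop
      (𝓝 (toPath fun a => Mstar σ μ B a ω)) :=
  tendsto_toPath (continuous_Wrev hμ hb hσ hw) (continuous_Mstar hμ hb hσ)
    (eventually_Wrev_coe_eq hμ hb hσ hw)

lemma tendsto_Wrev_infty (hμ : IsDriftFunction μ) (hb : IsDriftDominated fun t => B t ω)
    (hσ : 0 < σ) (hw : IsFiniteInitialPath w ω) (hd : 0 < driftExt μ ∞) :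
    Tendsto (fun t => Wrev σ μ B w t ∞ ω) atTop (𝓝 (Mstar σ μ B ∞ ω)) :=
  tendsto_const_nhds.congr' <| (eventually_Wrev_eq hμ hb hσ hw ENNReal.top_ne_zero hd).mono
    fun _ ht => (ht ∞ le_rfl).symm

lemma tendsto_associatedMeasure_Wrev (hμ : IsDriftFunction μ)
    (hb : IsDriftDominated fun t => B t ω) (hσ : 0 < σ) (hw : IsFiniteInitialPath w ω)
    (hM : IsAdmissible fun a => Mstar σ μ B a ω) :
    Tendsto (fun t => associatedMeasure fun a => Wrev σ μ B w t a ω) atTop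
      (𝓝 (associatedMeasure fun a => Mstar σ μ B a ω)) :=
  tendsto_associatedMeasure (isAdmissible_Wrev hμ hb hσ hw hM) hM
    (eventually_Wrev_coe_eq hμ hb hσ hw) (fun t x _ => ofReal_Wrev_le_densityBound hμ hb hσ t x)
    (lintegral_densityBound_lt_top hM hw).ne

end BackwardConvergence

section AlmostSure

variable {Ω : Type*} [MeasurableSpace Ω] {P : Measure Ω} {σ : ℝ} {μ : ℝ → ℝ}
  {B : ℝ≥0 → Ω → ℝ} {w : ℝ≥0 → Ω → ℝ≥0}

lemma ae_isFiniteInitialPath (hw : IsFiniteInitialCondition P B w) :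
    ∀ᵐ ω ∂P, IsFiniteInitialPath w ω := by
  have hinfty : ∀ᵐ ω ∂P, initAtInfty w ω < ∞ :=
    ae_lt_top' (aemeasurable_initAtInfty hw.aemeasurable hw.monotone) hw.lintegral_infty_lt_top.ne
  have hmeas : AEMeasurable
      (fun ω => ∫⁻ a in Ioc (0 : ℝ) 1, ENNReal.ofReal (w a.toNNReal ω / a ^ 2)) P := by
    have hm (a : ℝ≥0) : AEMeasurable (fun ω => initExt w a ω) P := by
      simpa only [initExt_coe] using (hw.aemeasurable a).coe_nnreal_real
    have hc : ∀ᵐ ω ∂P, Continuous fun a : ℝ≥0 => initExt w a ω := by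
      filter_upwards [hw.continuous] with ω hω
      simp only [initExt_coe]
      exact NNReal.continuous_coe.comp hω
    simpa only [ENNReal.ofReal, initExt_coe] using
      aemeasurable_lintegral_density (f := fun ω a => initExt w a ω) hm hc (Ioc 0 1)
  filter_upwards [hw.continuous, hw.monotone, hw.zero, hinfty,
    ae_lt_top' hmeas hw.lintegral_lt_top.ne] with ω hcont hmono hzero htop hint
  exact ⟨hcont, hmono, hzero, htop, hint⟩

variable [IsProbabilityMeasure P]

lemma aemeasurable_toPath_Mstar (hB : IsBrownianReal B P) (hμ : IsDriftFunction μ)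
    (hσ : 0 < σ) : AEMeasurable (fun ω => toPath fun a => Mstar σ μ B a ω) P :=
  aemeasurable_toPath
    (fun a => aemeasurable_Mstar hB hσ fun h => hμ.driftExt_coe_pos (by exact_mod_cast h))
    ((ae_isDriftDominated hB).mono fun _ hω => continuous_Mstar hμ hω hσ)

lemma lintegral_Mstar_div_sq_le (hB : IsBrownianReal B P) (hμ : IsDriftFunction μ)
    (hσ : 0 < σ) {x : ℝ} (hx : 0 < x) :
    ∫⁻ ω, ENNReal.ofReal (Mstar σ μ B (ENNReal.ofReal x) ω / x ^ 2) ∂P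
      ≤ ENNReal.ofReal (σ ^ 2 / 2) * ENNReal.ofReal (1 / (x ^ 2 * μ x)) := by
  have hpos := hμ.pos x hx
  have hdrift : driftExt μ (ENNReal.ofReal x) = μ x := by
    rw [ENNReal.ofReal, IsDriftFunction.driftExt_coe, Real.coe_toNNReal _ hx.le]
  calc ∫⁻ ω, ENNReal.ofReal (Mstar σ μ B (ENNReal.ofReal x) ω / x ^ 2) ∂P
      = ENNReal.ofReal (1 / x ^ 2)
          * ∫⁻ ω, ENNReal.ofReal (Mstar σ μ B (ENNReal.ofReal x) ω) ∂P := by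
        rw [← lintegral_const_mul' _ _ ENNReal.ofReal_ne_top]
        simp only [← ENNReal.ofReal_mul (by positivity : 0 ≤ 1 / x ^ 2), one_div_mul_eq_div]
    _ ≤ ENNReal.ofReal (1 / x ^ 2) * ENNReal.ofReal (σ ^ 2 / (2 * μ x)) := by
        gcongr
        rw [← hdrift]
        exact lintegral_Mstar_le hB hσ (ENNReal.ofReal_pos.2 hx).ne' (hdrift ▸ hpos)
    _ = ENNReal.ofReal (σ ^ 2 / 2) * ENNReal.ofReal (1 / (x ^ 2 * μ x)) := by
        rw [← ENNReal.ofReal_mul (by positivity), ← ENNReal.ofReal_mul (by positivity)]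
        congr 1
        field_simp

lemma ae_isAdmissible_Mstar (hB : IsBrownianReal B P) (hμ : IsDriftFunction μ) (hσ : 0 < σ)
    (hint : (∫⁻ a in Ioi (0 : ℝ), ENNReal.ofReal (1 / (a ^ 2 * μ a))) < ∞) :
    ∀ᵐ ω ∂P, IsAdmissible fun a => Mstar σ μ B a ω := by
  have hgood := ae_isDriftDominated hB
  have hfin := calc
    ∫⁻ x in Ioi (0 : ℝ), ∫⁻ ω, ENNReal.ofReal (Mstar σ μ B (ENNReal.ofReal x) ω / x ^ 2) ∂P
      ≤ ∫⁻ x in Ioi (0 : ℝ), ENNReal.ofReal (σ ^ 2 / 2) * ENNReal.ofReal (1 / (x ^ 2 * μ x)) :=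
        setLIntegral_mono' measurableSet_Ioi fun _ => lintegral_Mstar_div_sq_le hB hμ hσ
    _ = ENNReal.ofReal (σ ^ 2 / 2) * ∫⁻ x in Ioi (0 : ℝ), ENNReal.ofReal (1 / (x ^ 2 * μ x)) :=
        lintegral_const_mul' _ _ ENNReal.ofReal_ne_top
    _ < ∞ := ENNReal.mul_lt_top ENNReal.ofReal_lt_top hint
  filter_upwards [hgood, ae_lintegral_density_lt_top (f := fun ω a => Mstar σ μ B a ω)
    (fun a => aemeasurable_Mstar hB hσ fun h => hμ.driftExt_coe_pos (by exact_mod_cast h))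
    (hgood.mono fun _ hω => continuous_Mstar hμ hω hσ) hfin] with ω hb hM
  exact isAdmissible_Mstar hμ hb hσ hM

lemma ae_isAdmissible_W (hB : IsBrownianReal B P) (hμ : IsDriftFunction μ) (hσ : 0 < σ)
    (hw : ∀ᵐ ω ∂P, IsFiniteInitialPath w ω)
    (hint : (∫⁻ a in Ioi (0 : ℝ), ENNReal.ofReal (1 / (a ^ 2 * μ a))) < ∞) (t : ℝ≥0) :
    ∀ᵐ ω ∂P, IsAdmissible fun a => W σ μ B w t a ω := by
  filter_upwards [ae_isDriftDominated hB, hw,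
    ae_isAdmissible_Mstar (isBrownianReal_revProc hB t) hμ hσ hint] with ω hb hinit hM
  simp only [W_eq_Wrev_revProc hb.continuous hb.zero]
  exact isAdmissible_Wrev hμ (hb.revProc t) hσ hinit hM t

lemma aemeasurable_associatedMeasure_Mstar (hB : IsBrownianReal B P) (hμ : IsDriftFunction μ)
    (hσ : 0 < σ) (hint : (∫⁻ a in Ioi (0 : ℝ), ENNReal.ofReal (1 / (a ^ 2 * μ a))) < ∞) :
    AEMeasurable (fun ω => associatedMeasure fun a => Mstar σ μ B a ω) P :=
  (measurable_pathMeasure.comp_aemeasurable (aemeasurable_toPath_Mstar hB hμ hσ)).congr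
    ((ae_isAdmissible_Mstar hB hμ hσ hint).mono fun _ hM => hM.pathMeasure_toPath)

lemma ae_nonneg_and_continuous (hB : IsBrownianReal B P) (hμ : IsDriftFunction μ) (hσ : 0 < σ)
    (hw : ∀ᵐ ω ∂P, IsFiniteInitialPath w ω) :
    ∀ᵐ ω ∂P,
      (∀ t a, 0 ≤ W σ μ B w t a ω) ∧
      (∀ t, Continuous fun a : ℝ≥0 => W σ μ B w t a ω) ∧
      (∀ a, 0 ≤ Mstar σ μ B a ω) ∧
      (∀ a : ℝ≥0, BddAbove (range fun t => X σ μ B t a ω)) ∧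
      (Continuous fun a : ℝ≥0 => Mstar σ μ B a ω) := by
  filter_upwards [ae_isDriftDominated hB, hw] with ω hb hinit
  simp only [W_eq_Wrev_revProc hb.continuous hb.zero]
  exact ⟨fun t => Wrev_nonneg (hb.revProc t).continuous (hb.revProc t).zero t,
    fun t => continuous_Wrev hμ (hb.revProc t) hσ hinit t, Mstar_nonneg hb.zero,
    fun a => bddAbove_X hb hσ fun ha => hμ.driftExt_coe_pos (by exact_mod_cast ha),
    continuous_Mstar hμ hb hσ⟩

end AlmostSure

section ConvergenceInDistribution

variable {Ω : Type*} [MeasurableSpace Ω] {P : Measure Ω} [IsProbabilityMeasure P] {σ : ℝ}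
  {μ : ℝ → ℝ} {B : ℝ≥0 → Ω → ℝ} {w : ℝ≥0 → Ω → ℝ≥0}

lemma convergesInDistribution_of_ae_tendsto_Wrev (hB : IsBrownianReal B P)
    (hμ : IsDriftFunction μ) (hσ : 0 < σ) (hwm : ∀ a, AEMeasurable (w a) P)
    (hi : IndepFun (fun ω a => w a ω) (fun ω t => B t ω) P)
    (hw : ∀ᵐ ω ∂P, IsFiniteInitialPath w ω) {S : Type*} [TopologicalSpace S]
    [MeasurableSpace S] [OpensMeasurableSpace S] {Φ : C(ℝ≥0, ℝ) × ℝ → S} (hΦ : Measurable Φ)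
    {Y : ℝ≥0 → Ω → S} {Z : Ω → S}
    (hY : ∀ t, ∀ᵐ ω ∂P, Φ (toPath fun a => W σ μ B w t a ω, W σ μ B w t ∞ ω) = Y t ω)
    (hZ : AEMeasurable Z P)
    (hlim : ∀ᵐ ω ∂P, Tendsto
      (fun t => Φ (toPath fun a => Wrev σ μ B w t a ω, Wrev σ μ B w t ∞ ω)) atTop (𝓝 (Z ω))) :
    ConvergesInDistribution P Y Z := by
  refine convergesInDistribution_of_identDistrib (fun t => ?_) hZ hlim
  have hlaw := identDistrib_W_Wrev (σ := σ) (μ := μ) hB hwm (hw.mono fun _ hω => hω.monotone) hi t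
  refine identDistrib_congr ((identDistrib_toPath_prodMk hlaw ?_ ?_).comp hΦ) (hY t) .rfl
  · exact (ae_nonneg_and_continuous hB hμ hσ hw).mono fun _ hω => hω.2.1 t
  · filter_upwards [ae_isDriftDominated hB, hw] with ω hb hinit
    exact continuous_Wrev hμ hb hσ hinit t

lemma convergesInDistribution_toPath_W (hB : IsBrownianReal B P) (hμ : IsDriftFunction μ)
    (hσ : 0 < σ) (hwm : ∀ a, AEMeasurable (w a) P)
    (hi : IndepFun (fun ω a => w a ω) (fun ω t => B t ω) P)
    (hw : ∀ᵐ ω ∂P, IsFiniteInitialPath w ω) :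
    ConvergesInDistribution P (fun t ω => toPath fun a => W σ μ B w t a ω)
      (fun ω => toPath fun a => Mstar σ μ B a ω) := by
  refine convergesInDistribution_of_ae_tendsto_Wrev hB hμ hσ hwm hi hw measurable_fst
    (fun t => .of_forall fun _ => rfl) (aemeasurable_toPath_Mstar hB hμ hσ) ?_
  filter_upwards [ae_isDriftDominated hB, hw] with ω hb hinit
  exact tendsto_toPath_Wrev hμ hb hσ hinit

lemma convergesInDistribution_toPath_W_infty (hB : IsBrownianReal B P) (hμ : IsDriftFunction μ)
    (hσ : 0 < σ) (hwm : ∀ a, AEMeasurable (w a) P)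
    (hi : IndepFun (fun ω a => w a ω) (fun ω t => B t ω) P)
    (hw : ∀ᵐ ω ∂P, IsFiniteInitialPath w ω) (hd : 0 < driftExt μ ∞) :
    ConvergesInDistribution P
      (fun t ω => (toPath fun a => W σ μ B w t a ω, (W σ μ B w t ∞ ω).toNNReal))
      (fun ω => (toPath fun a => Mstar σ μ B a ω, (Mstar σ μ B ∞ ω).toNNReal)) := by
  refine convergesInDistribution_of_ae_tendsto_Wrev hB hμ hσ hwm hi hw
    (Φ := fun p => (p.1, p.2.toNNReal)) (by fun_prop) (fun t => .of_forall fun _ => rfl)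
    ((aemeasurable_toPath_Mstar hB hμ hσ).prodMk
      (aemeasurable_Mstar hB hσ fun _ => hd).real_toNNReal) ?_
  filter_upwards [ae_isDriftDominated hB, hw] with ω hb hinit
  exact (tendsto_toPath_Wrev hμ hb hσ hinit).prodMk_nhds
    (tendsto_real_toNNReal (tendsto_Wrev_infty hμ hb hσ hinit hd))

lemma convergesInDistribution_toPath_W_associatedMeasure (hB : IsBrownianReal B P)
    (hμ : IsDriftFunction μ) (hσ : 0 < σ) (hwm : ∀ a, AEMeasurable (w a) P)
    (hi : IndepFun (fun ω a => w a ω) (fun ω t => B t ω) P)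
    (hw : ∀ᵐ ω ∂P, IsFiniteInitialPath w ω)
    (hint : (∫⁻ a in Ioi (0 : ℝ), ENNReal.ofReal (1 / (a ^ 2 * μ a))) < ∞) :
    ConvergesInDistribution P
      (fun t ω => (toPath fun a => W σ μ B w t a ω, associatedMeasure fun a => W σ μ B w t a ω))
      (fun ω => (toPath fun a => Mstar σ μ B a ω, associatedMeasure fun a => Mstar σ μ B a ω)) := by
  refine convergesInDistribution_of_ae_tendsto_Wrev hB hμ hσ hwm hi hw
    (Φ := fun p => (p.1, pathMeasure p.1))
    (measurable_fst.prodMk (measurable_pathMeasure.comp measurable_fst))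
    (fun t => (ae_isAdmissible_W hB hμ hσ hw hint t).mono fun _ hW => by
      simp only [hW.pathMeasure_toPath])
    ((aemeasurable_toPath_Mstar hB hμ hσ).prodMk
      (aemeasurable_associatedMeasure_Mstar hB hμ hσ hint)) ?_
  filter_upwards [ae_isDriftDominated hB, hw, ae_isAdmissible_Mstar hB hμ hσ hint]
    with ω hb hinit hM
  simp only [(isAdmissible_Wrev hμ hb hσ hinit hM _).pathMeasure_toPath]
  exact (tendsto_toPath_Wrev hμ hb hσ hinit).prodMk_nhds
    (tendsto_associatedMeasure_Wrev hμ hb hσ hinit hM)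

lemma convergesInDistribution_toPath_W_infty_associatedMeasure (hB : IsBrownianReal B P)
    (hμ : IsDriftFunction μ) (hσ : 0 < σ) (hwm : ∀ a, AEMeasurable (w a) P)
    (hi : IndepFun (fun ω a => w a ω) (fun ω t => B t ω) P)
    (hw : ∀ᵐ ω ∂P, IsFiniteInitialPath w ω)
    (hint : (∫⁻ a in Ioi (0 : ℝ), ENNReal.ofReal (1 / (a ^ 2 * μ a))) < ∞)
    (hd : 0 < driftExt μ ∞) :
    ConvergesInDistribution P
      (fun t ω => (toPath fun a => W σ μ B w t a ω, (W σ μ B w t ∞ ω).toNNReal,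
        associatedMeasure fun a => W σ μ B w t a ω))
      (fun ω => (toPath fun a => Mstar σ μ B a ω, (Mstar σ μ B ∞ ω).toNNReal,
        associatedMeasure fun a => Mstar σ μ B a ω)) := by
  refine convergesInDistribution_of_ae_tendsto_Wrev hB hμ hσ hwm hi hw
    (Φ := fun p => (p.1, p.2.toNNReal, pathMeasure p.1))
    (measurable_fst.prodMk
      (measurable_snd.real_toNNReal.prodMk (measurable_pathMeasure.comp measurable_fst)))
    (fun t => (ae_isAdmissible_W hB hμ hσ hw hint t).mono fun _ hW => by
      simp only [hW.pathMeasure_toPath])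
    ((aemeasurable_toPath_Mstar hB hμ hσ).prodMk
      ((aemeasurable_Mstar hB hσ fun _ => hd).real_toNNReal.prodMk
        (aemeasurable_associatedMeasure_Mstar hB hμ hσ hint))) ?_
  filter_upwards [ae_isDriftDominated hB, hw, ae_isAdmissible_Mstar hB hμ hσ hint]
    with ω hb hinit hM
  simp only [(isAdmissible_Wrev hμ hb hσ hinit hM _).pathMeasure_toPath]
  exact (tendsto_toPath_Wrev hμ hb hσ hinit).prodMk_nhds
    ((tendsto_real_toNNReal (tendsto_Wrev_infty hμ hb hσ hinit hd)).prodMk_nhds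
      (tendsto_associatedMeasure_Wrev hμ hb hσ hinit hM))

end ConvergenceInDistribution

end RCBM

end

theorem theorem1_general {Ω : Type*} [MeasurableSpace Ω] (P : Measure Ω) [IsProbabilityMeasure P]
    (B : ℝ≥0 → Ω → ℝ) (hB : IsBrownianReal B P)
    (σ : ℝ) (hσ : 0 < σ) (μ : ℝ → ℝ) (hμ : RCBM.IsDriftFunction μ)
    (w : ℝ≥0 → Ω → ℝ≥0) (hwm : ∀ a, AEMeasurable (w a) P)
    (hi : IndepFun (fun ω a => w a ω) (fun ω t => B t ω) P)
    (hw : ∀ᵐ ω ∂P, RCBM.IsFiniteInitialPath w ω) :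
    (∀ᵐ ω ∂P,
      (∀ t a, 0 ≤ RCBM.W σ μ B w t a ω) ∧
      (∀ t, Continuous fun a : ℝ≥0 => RCBM.W σ μ B w t a ω) ∧
      (∀ a, 0 ≤ RCBM.Mstar σ μ B a ω) ∧
      (∀ a : ℝ≥0, BddAbove (range fun t => RCBM.X σ μ B t a ω)) ∧
      (Continuous fun a : ℝ≥0 => RCBM.Mstar σ μ B a ω)) ∧
    RCBM.ConvergesInDistribution P
      (fun t ω => RCBM.toPath fun a => RCBM.W σ μ B w t a ω)
      (fun ω => RCBM.toPath fun a => RCBM.Mstar σ μ B a ω) ∧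
    (0 < RCBM.driftAtInfty μ →
      (∀ᵐ ω ∂P, BddAbove (range fun t => RCBM.X σ μ B t ∞ ω)) ∧
      RCBM.ConvergesInDistribution P
        (fun t ω => (RCBM.toPath fun a => RCBM.W σ μ B w t a ω,
          (RCBM.W σ μ B w t ∞ ω).toNNReal))
        (fun ω => (RCBM.toPath fun a => RCBM.Mstar σ μ B a ω,
          (RCBM.Mstar σ μ B ∞ ω).toNNReal))) ∧
    ((∫⁻ a in Ioi (0 : ℝ), ENNReal.ofReal (1 / (a ^ 2 * μ a))) < ∞ →
      (∀ t, ∀ᵐ ω ∂P, ∃! ζ : FiniteMeasure ℝ≥0,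
        RCBM.IsAssociatedMeasure (fun a => RCBM.W σ μ B w t a ω) ζ) ∧
      (∀ᵐ ω ∂P, ∃! ζ : FiniteMeasure ℝ≥0,
        RCBM.IsAssociatedMeasure (fun a => RCBM.Mstar σ μ B a ω) ζ) ∧
      RCBM.ConvergesInDistribution P
        (fun t ω => (RCBM.toPath fun a => RCBM.W σ μ B w t a ω,
          RCBM.associatedMeasure fun a => RCBM.W σ μ B w t a ω))
        (fun ω => (RCBM.toPath fun a => RCBM.Mstar σ μ B a ω,
          RCBM.associatedMeasure fun a => RCBM.Mstar σ μ B a ω)) ∧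
      (0 < RCBM.driftAtInfty μ →
        RCBM.ConvergesInDistribution P
          (fun t ω => (RCBM.toPath fun a => RCBM.W σ μ B w t a ω,
            (RCBM.W σ μ B w t ∞ ω).toNNReal,
            RCBM.associatedMeasure fun a => RCBM.W σ μ B w t a ω))
          (fun ω => (RCBM.toPath fun a => RCBM.Mstar σ μ B a ω,
            (RCBM.Mstar σ μ B ∞ ω).toNNReal,
            RCBM.associatedMeasure fun a => RCBM.Mstar σ μ B a ω)))) := by
  have hdrift (hd : 0 < RCBM.driftAtInfty μ) : 0 < RCBM.driftExt μ ∞ := by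
    rwa [RCBM.IsDriftFunction.driftExt_infty]
  refine ⟨RCBM.ae_nonneg_and_continuous hB hμ hσ hw,
    RCBM.convergesInDistribution_toPath_W hB hμ hσ hwm hi hw, fun hd => ⟨?_, ?_⟩,
    fun hint => ⟨fun t => ?_, ?_, ?_, fun hd => ?_⟩⟩
  · exact (RCBM.ae_isDriftDominated hB).mono fun _ hb => RCBM.bddAbove_X hb hσ fun _ => hdrift hd
  · exact RCBM.convergesInDistribution_toPath_W_infty hB hμ hσ hwm hi hw (hdrift hd)
  · exact (RCBM.ae_isAdmissible_W hB hμ hσ hw hint t).mono fun _ hW => hW.existsUnique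
  · exact (RCBM.ae_isAdmissible_Mstar hB hμ hσ hint).mono fun _ hM => hM.existsUnique
  · exact RCBM.convergesInDistribution_toPath_W_associatedMeasure hB hμ hσ hwm hi hw hint
  · exact RCBM.convergesInDistribution_toPath_W_infty_associatedMeasure hB hμ hσ hwm hi hw hint
      (hdrift hd)

theorem theorem1 {Ω : Type*} [MeasurableSpace Ω] (P : Measure Ω) [IsProbabilityMeasure P]
    (B : ℝ≥0 → Ω → ℝ) (hB : IsBrownianReal B P)
    (σ : ℝ) (hσ : 0 < σ) (μ : ℝ → ℝ) (hμ : RCBM.IsDriftFunction μ)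
    (w : ℝ≥0 → Ω → ℝ≥0) (hw : RCBM.IsFiniteInitialCondition P B w) :
    -- the processes are well defined: almost surely nonnegative, finite and continuous in `a`
    (∀ᵐ ω ∂P,
      (∀ t a, 0 ≤ RCBM.W σ μ B w t a ω) ∧
      (∀ t, Continuous fun a : ℝ≥0 => RCBM.W σ μ B w t a ω) ∧
      (∀ a, 0 ≤ RCBM.Mstar σ μ B a ω) ∧
      (∀ a : ℝ≥0, BddAbove (range fun t => RCBM.X σ μ B t a ω)) ∧
      (Continuous fun a : ℝ≥0 => RCBM.Mstar σ μ B a ω)) ∧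
    -- (i)
    RCBM.ConvergesInDistribution P
      (fun t ω => RCBM.toPath fun a => RCBM.W σ μ B w t a ω)
      (fun ω => RCBM.toPath fun a => RCBM.Mstar σ μ B a ω) ∧
    (0 < RCBM.driftAtInfty μ →
      (∀ᵐ ω ∂P, BddAbove (range fun t => RCBM.X σ μ B t ∞ ω)) ∧
      RCBM.ConvergesInDistribution P
        (fun t ω => (RCBM.toPath fun a => RCBM.W σ μ B w t a ω,
          (RCBM.W σ μ B w t ∞ ω).toNNReal))
        (fun ω => (RCBM.toPath fun a => RCBM.Mstar σ μ B a ω,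
          (RCBM.Mstar σ μ B ∞ ω).toNNReal))) ∧
    -- (ii)
    ((∫⁻ a in Ioi (0 : ℝ), ENNReal.ofReal (1 / (a ^ 2 * μ a))) < ∞ →
      (∀ t, ∀ᵐ ω ∂P, ∃! ζ : FiniteMeasure ℝ≥0,
        RCBM.IsAssociatedMeasure (fun a => RCBM.W σ μ B w t a ω) ζ) ∧
      (∀ᵐ ω ∂P, ∃! ζ : FiniteMeasure ℝ≥0,
        RCBM.IsAssociatedMeasure (fun a => RCBM.Mstar σ μ B a ω) ζ) ∧
      RCBM.ConvergesInDistribution P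
        (fun t ω => (RCBM.toPath fun a => RCBM.W σ μ B w t a ω,
          RCBM.associatedMeasure fun a => RCBM.W σ μ B w t a ω))
        (fun ω => (RCBM.toPath fun a => RCBM.Mstar σ μ B a ω,
          RCBM.associatedMeasure fun a => RCBM.Mstar σ μ B a ω)) ∧
      (0 < RCBM.driftAtInfty μ →
        RCBM.ConvergesInDistribution P
          (fun t ω => (RCBM.toPath fun a => RCBM.W σ μ B w t a ω,
            (RCBM.W σ μ B w t ∞ ω).toNNReal,
            RCBM.associatedMeasure fun a => RCBM.W σ μ B w t a ω))
          (fun ω => (RCBM.toPath fun a => RCBM.Mstar σ μ B a ω,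
            (RCBM.Mstar σ μ B ∞ ω).toNNReal,
            RCBM.associatedMeasure fun a => RCBM.Mstar σ μ B a ω)))) :=
  theorem1_general P B hB σ hσ μ hμ w hw.aemeasurable hw.indep (RCBM.ae_isFiniteInitialPath hw)
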